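/- Let $(n_k)_{k\ge 1}$ be a sequence of positive integers satisfying the Hadamard gap condition $n_{k+1}/n_k\ge q>1$ $(k=1,2,\ldots)$ for some $q>1$, and condition $\mathbf B_2$: for any nonzero integers $a,b$ there is a constant $K(a,b)$ such that for every nonzero integer $c$ the equation $an_k+bn_l=c$ has at most $K(a,b)$ solutions $(k,l)$. Let $f:\mathbb R\to\mathbb R$ be a measurable function with $f(x+1)=f(x)$ for all $x$, $\int_0^1 f(x)\,dx=0$ and finite total variation on $[0,1]$, and let $\sigma$ be a permutation of the positive integers. Regard $N^{-1/2}\sum_{k=1}^N f(n_{\sigma(k)}x)$ as random variables on $(0,1)$ with Lebesgue measure. They converge in distribution to some probability law on $\mathbb R$ as $N\to\infty$ if and only if the (finite) limit $$\gamma=\lim_{N\to\infty}N^{-1}\int_0^1\Big(\sum_{k=1}^N f(n_{\sigma(k)}x)\Big)^2dx$$ exists, and in that case $$N^{-1/2}\sum_{k=1}^N f(n_{\sigma(k)}x)\ \xrightarrow{\ d\ }\ N(0,\gamma),$$ where for $\gamma=0$ the law $N(0,0)$ is the point mass at $0$. -/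

import Mathlib

open MeasureTheory ProbabilityTheory Filter Topology Set

noncomputable section

/-- The Hadamard gap condition: `n (k+1) / n k ≥ q` for all `k`, for some `q > 1`.
(Sequences are indexed by `ℕ`, starting at `0`.) -/
def HadamardGap (n : ℕ → ℕ) : Prop :=
  ∃ q : ℝ, 1 < q ∧ ∀ k : ℕ, q ≤ (n (k + 1) : ℝ) / (n k : ℝ)

/-- Condition `B₂`: for all nonzero integers `a, b` there is a bound `K`, depending only on `a, b`,
such that for every nonzero integer `c` the equation `a n_k + b n_l = c` has at most `K`
solutions `(k, l)`. -/
def ConditionB2 (n : ℕ → ℕ) : Prop :=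
  ∀ a b : ℤ, a ≠ 0 → b ≠ 0 → ∃ K : ℕ, ∀ c : ℤ, c ≠ 0 →
    {p : ℕ × ℕ | a * (n p.1 : ℤ) + b * (n p.2 : ℤ) = c}.encard ≤ K

/-- The probability space `(0, 1)` with Lebesgue measure. -/
def lebesgueUnit : Measure ℝ := volume.restrict (Ioo (0 : ℝ) 1)

instance : IsProbabilityMeasure lebesgueUnit :=
  ⟨by simp [lebesgueUnit]⟩

/-- The permuted sum `∑ f (n_{σ(k)} x)` over the first `N` indices `k`. -/
def permSum (f : ℝ → ℝ) (n : ℕ → ℕ) (σ : Equiv.Perm ℕ) (N : ℕ) (x : ℝ) : ℝ :=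
  ∑ k ∈ Finset.range N, f ((n (σ k) : ℝ) * x)

/-- The real random variables `X N` on `((0, 1), Lebesgue)` converge in distribution
to the probability law `ν` as `N → ∞`. -/
def ConvergesToLaw (X : ℕ → ℝ → ℝ) (ν : Measure ℝ) [IsProbabilityMeasure ν] : Prop :=
  TendstoInDistribution X atTop (id : ℝ → ℝ) (fun _ => lebesgueUnit) ν

/-- `γ` is the limit of `N⁻¹ ∫₀¹ (∑ f (n_{σ(k)} x))² dx` as `N → ∞`. -/
def IsLimitingVariance (f : ℝ → ℝ) (n : ℕ → ℕ) (σ : Equiv.Perm ℕ) (γ : ℝ) : Prop :=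
  Tendsto (fun N : ℕ => (N : ℝ)⁻¹ * ∫ x in (0 : ℝ)..1, (permSum f n σ N x) ^ 2) atTop (𝓝 γ)

end

open scoped ComplexConjugate

/-! For fixed `N` the permuted sum depends only on the set of its first `N` indices. Listed
increasingly, these give a subsequence of `n` with the same gap ratio `q` and the same counting
function `K`. The permutation is therefore harmless if a normal approximation holds uniformly over
all sequences with given `q` and `K`: the characteristic function of the normalized sum at `t`
differs from `exp (-t² v_N / 2)` by `o(1)`, where `v_N` is the actual second moment
(`exists_norm_integral_exp_lacunary_sub_gaussian_le`). If `v_N → γ`, Lévy's theorem gives the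
Gaussian limit. Conversely, convergence in law at `t = 1` makes `exp (-v_N / 2)` converge; since
`v_N` is bounded, the limit is positive and a logarithm recovers the limit of `v_N`.

For the uniform approximation, `f` is replaced by a Fourier partial sum `p`. The residual `r = f -
p` has small norm, and its dilates have geometrically decaying correlations because `f` has bounded
variation, so its lacunary sums are small in mean square (`integral_sq_sum_residual_le`).

For `p`, indices are cut into long blocks separated by short gaps, so that distinct blocks occupy
separated frequency bands. If `X_b` are the normalized block sums times `t`, then `∏ (1 + i X_b)`
has integral exactly `1`. From `exp (ix) = (1 + ix) exp (-x²/2) + O(|x|³)` the characteristic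
function is close to `exp (-v/2)` once `∑ X_b²` concentrates at its mean `v`
(`norm_integral_exp_sub_le`). This concentration is where `B₂` enters: it bounds how often a nonzero
frequency occurs in `∑ X_b²`. The zero frequency only contributes to `v`, so solutions with `c = 0`
need no bound. -/

/-! ### Periodic functions of bounded variation -/

theorem eVariationOn_Icc_natCast {f : ℝ → ℝ} (hper : Function.Periodic f 1) (m : ℕ) :
    eVariationOn f (Icc (0 : ℝ) m) = m * eVariationOn f (Icc (0 : ℝ) 1) := by
  have hI : Monotone (fun i : ℕ => (i : ℝ)) := Nat.mono_cast
  have h := eVariationOn.sum' f hI (n := m)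
  simp only [Nat.cast_zero] at h
  rw [← h]
  have key : ∀ i : ℕ, eVariationOn f (Icc (i : ℝ) ((i + 1 : ℕ) : ℝ)) =
      eVariationOn f (Icc (0 : ℝ) 1) := by
    intro i
    have hmono : MonotoneOn (fun x : ℝ => x + i) (Icc (0 : ℝ) 1) :=
      fun a _ b _ hab => by simpa using hab
    have h1 := eVariationOn.comp_eq_of_monotoneOn f (fun x : ℝ => x + i) hmono
    have h2 : f ∘ (fun x : ℝ => x + i) = f := by
      funext x
      simpa using hper.nat_mul i x
    rw [h2] at h1
    rw [h1]
    congr 1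
    rw [Set.image_add_const_Icc]
    push_cast
    rw [zero_add, add_comm]
  simp only [key, Finset.sum_const, Finset.card_range, nsmul_eq_mul]

/-- A monotone function dominating the increments of a periodic function of bounded variation. -/
theorem exists_dominating_variation {f : ℝ → ℝ} (hper : Function.Periodic f 1)
    (hvar : BoundedVariationOn f (Icc (0 : ℝ) 1)) :
    ∃ (V : ℝ) (T : ℝ → ℝ), 0 ≤ V ∧
      (∀ x y, 0 ≤ x → x ≤ y → |f y - f x| ≤ T y - T x) ∧ ∀ m : ℕ, T m - T 0 ≤ m * V := by
  have hfin : ∀ x : ℝ, eVariationOn f (Icc 0 x) ≠ ⊤ := by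
    intro x
    refine ne_top_of_le_ne_top ?_ (eVariationOn.mono f
      (Icc_subset_Icc_right (Nat.le_ceil x)))
    rw [eVariationOn_Icc_natCast hper]
    exact ENNReal.mul_ne_top (ENNReal.natCast_ne_top _) hvar
  refine ⟨(eVariationOn f (Icc 0 1)).toReal, fun x => (eVariationOn f (Icc 0 x)).toReal,
    ENNReal.toReal_nonneg, fun x y hx hxy => ?_, fun m => ?_⟩
  · have hadd := eVariationOn.Icc_add_Icc f (s := univ) hx hxy (mem_univ _)
    simp only [univ_inter] at hadd
    have hfin' : eVariationOn f (Icc x y) ≠ ⊤ :=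
      ne_top_of_le_ne_top (hfin y) (eVariationOn.mono f (Icc_subset_Icc_left hx))
    beta_reduce
    rw [← hadd, ENNReal.toReal_add (hfin x) hfin', add_sub_cancel_left]
    have := BoundedVariationOn.dist_le hfin' (right_mem_Icc.2 hxy) (left_mem_Icc.2 hxy)
    simpa [Real.dist_eq] using this
  · beta_reduce
    rw [eVariationOn_Icc_natCast hper, ENNReal.toReal_mul]
    simp

theorem exists_bound_of_boundedVariation {f : ℝ → ℝ} (hper : Function.Periodic f 1)
    (hvar : BoundedVariationOn f (Icc (0 : ℝ) 1)) : ∃ M : ℝ, 0 ≤ M ∧ ∀ x, |f x| ≤ M := by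
  refine ⟨|f 0| + (eVariationOn f (Icc (0 : ℝ) 1)).toReal, by positivity, fun x => ?_⟩
  have hx : Int.fract x ∈ Icc (0 : ℝ) 1 := ⟨Int.fract_nonneg x, (Int.fract_lt_one x).le⟩
  have h := BoundedVariationOn.dist_le hvar hx (left_mem_Icc.2 zero_le_one)
  have h2 : f (Int.fract x) = f x := by
    have := hper.sub_int_mul_eq (x := x) ⌊x⌋
    simpa only [mul_one, Int.self_sub_floor] using this
  rw [h2, Real.dist_eq] at h
  have := abs_sub_abs_le_abs_sub (f x) (f 0)
  linarith

/-! ### Integrals over a period and correlations of dilates -/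

theorem integral_lebesgueUnit {E : Type*} [NormedAddCommGroup E] [NormedSpace ℝ E] (g : ℝ → E) :
    ∫ x, g x ∂lebesgueUnit = ∫ x in (0 : ℝ)..1, g x := by
  rw [intervalIntegral.integral_of_le zero_le_one, integral_Ioc_eq_integral_Ioo, lebesgueUnit]

theorem intervalIntegrable_of_bound {E : Type*} [NormedAddCommGroup E] [NormedSpace ℝ E]
    {g : ℝ → E} (hg : AEStronglyMeasurable g volume) (M : ℝ) (hM : ∀ x, ‖g x‖ ≤ M) (a b : ℝ) :
    IntervalIntegrable g volume a b := by
  rw [intervalIntegrable_iff]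
  exact Measure.integrableOn_of_bounded (by simp) hg (ae_of_all _ hM)

theorem integral_comp_nat_mul_eq_sum {E : Type*} [NormedAddCommGroup E] [NormedSpace ℝ E]
    {G : ℝ → E} (hG : ∀ a b, IntervalIntegrable G volume a b) {n : ℕ} (hn : 0 < n) :
    ∫ x in (0 : ℝ)..1, G (n * x) =
      (n : ℝ)⁻¹ • ∑ s ∈ Finset.range n, ∫ y in (0 : ℝ)..1, G (y + s) := by
  have hn' : (n : ℝ) ≠ 0 := by positivity
  rw [intervalIntegral.integral_comp_mul_left _ hn']
  congr 1
  have h := intervalIntegral.sum_integral_adjacent_intervals (f := G) (μ := volume)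
    (a := fun k : ℕ => (k : ℝ)) (n := n) (fun k _ => hG _ _)
  simp only [Nat.cast_zero] at h
  rw [mul_zero, mul_one, ← h]
  refine Finset.sum_congr rfl fun s _ => ?_
  rw [intervalIntegral.integral_comp_add_right]
  push_cast
  rw [zero_add, add_comm]

theorem Function.Periodic.integral_comp_nat_mul {E : Type*} [NormedAddCommGroup E]
    [NormedSpace ℝ E] {G : ℝ → E} (hper : Function.Periodic G 1)
    (hG : ∀ a b, IntervalIntegrable G volume a b) {n : ℕ} (hn : 0 < n) :
    ∫ x in (0 : ℝ)..1, G (n * x) = ∫ x in (0 : ℝ)..1, G x := by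
  have hn' : (n : ℝ) ≠ 0 := by positivity
  rw [integral_comp_nat_mul_eq_sum hG hn]
  have : ∀ s : ℕ, ∀ y, G (y + s) = G y := fun s y => by simpa using hper.nat_mul s y
  simp only [this, Finset.sum_const, Finset.card_range]
  rw [← Nat.cast_smul_eq_nsmul ℝ, smul_smul, inv_mul_cancel₀ hn', one_smul]

/-- Correlation of two dilated periodic functions, the slower one of bounded variation and the
faster one of mean zero. -/
theorem abs_integral_mul_comp_le {g h T : ℝ → ℝ} {V Mg Mh : ℝ} (hg : Measurable g)
    (hgb : ∀ x, |g x| ≤ Mg) (hT : ∀ x y, 0 ≤ x → x ≤ y → |g y - g x| ≤ T y - T x)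
    (hTm : ∀ m : ℕ, T m - T 0 ≤ m * V) (hh : Measurable h) (hper : Function.Periodic h 1)
    (hhb : ∀ x, |h x| ≤ Mh) (hmean : ∫ x in (0 : ℝ)..1, h x = 0) {m n : ℕ} (hn : 0 < n) :
    |∫ x in (0 : ℝ)..1, g (m * x) * h (n * x)| ≤
      (m / n : ℝ) * V * ∫ x in (0 : ℝ)..1, |h x| := by
  have hn' : (0 : ℝ) < n := by positivity
  have hMg : 0 ≤ Mg := (abs_nonneg _).trans (hgb 0)
  have hMh : 0 ≤ Mh := (abs_nonneg _).trans (hhb 0)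
  set c : ℝ := m / n with hc
  have hc0 : 0 ≤ c := by positivity
  -- The bound `2 * Mg` serves both for dilates of `g` and for their increments.
  have hInt : ∀ u : ℝ → ℝ, Measurable u → (∀ x, |u x| ≤ 2 * Mg) → ∀ a b,
      IntervalIntegrable (fun y => u y * h y) volume a b := fun u hu hub a b =>
    intervalIntegrable_of_bound (hu.mul hh).aestronglyMeasurable (2 * Mg * Mh) (fun x => by
      rw [Pi.mul_apply, norm_mul]
      exact mul_le_mul (hub x) (hhb x) (norm_nonneg _) (by positivity)) a b
  have hhInt : IntervalIntegrable h volume 0 1 :=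
    intervalIntegrable_of_bound hh.aestronglyMeasurable Mh hhb _ _
  -- With `y = n x` the integral runs over `[0, n]`, where `h` has period `1` and `g` is slowed down
  -- by `c = m / n`; it is then cut at the integers.
  have h1 : (fun x : ℝ => g (m * x) * h (n * x)) =
      fun x => (fun y => g (c * y) * h y) (n * x) := by
    funext x
    simp only
    congr 2
    rw [hc]; field_simp
  rw [h1, integral_comp_nat_mul_eq_sum (hInt (fun y => g (c * y))
    (hg.comp (measurable_const_mul c)) (fun x => by linarith [hgb (c * x)])) hn]
  have hshift : ∀ s : ℕ, ∀ y, h (y + s) = h y := fun s y => by simpa using hper.nat_mul s y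
  have hincr : ∀ s : ℕ, Measurable fun y => g (c * (y + s)) - g (c * s) := fun s =>
    (hg.comp ((measurable_id.add_const _).const_mul c)).sub_const _
  have hincrb : ∀ (s : ℕ) (y : ℝ), |g (c * (y + s)) - g (c * s)| ≤ 2 * Mg := fun s y =>
    (abs_sub _ _).trans (by linarith [hgb (c * (y + s)), hgb (c * s)])
  -- As `h` has mean zero, the value of the slow factor at the left end of each unit interval may be
  -- subtracted.
  have h2 : ∀ s : ℕ, ∫ y in (0 : ℝ)..1, g (c * (y + s)) * h (y + s) =
      ∫ y in (0 : ℝ)..1, (g (c * (y + s)) - g (c * s)) * h y := by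
    intro s
    simp only [hshift, sub_mul]
    rw [intervalIntegral.integral_sub, intervalIntegral.integral_const_mul, hmean]
    · simp
    · exact hInt (fun y => g (c * (y + s)))
        (hg.comp ((measurable_id.add_const _).const_mul c)) (fun x => by linarith [hgb (c * (x + s))]) _ _
    · exact hhInt.const_mul _
  simp only [h2]
  rw [← intervalIntegral.integral_finsetSum (fun s _ => hInt _ (hincr s) (hincrb s) _ _),
    smul_eq_mul, abs_mul, abs_of_pos (inv_pos.2 hn')]
  -- The increments lie over the adjacent intervals `[c s, c (s + 1)]`, so the bounds by `T`
  -- telescope up to `c n = m`.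
  have hpt : ∀ y ∈ Icc (0 : ℝ) 1,
      ∑ s ∈ Finset.range n, |g (c * (y + s)) - g (c * s)| ≤ m * V := by
    intro y hy
    refine le_trans ?_ (hTm m)
    have hTmono : ∀ a b, 0 ≤ a → a ≤ b → T a ≤ T b := fun a b ha hab => by
      linarith [hT a b ha hab, abs_nonneg (g b - g a)]
    calc ∑ s ∈ Finset.range n, |g (c * (y + s)) - g (c * s)|
        ≤ ∑ s ∈ Finset.range n, (T (c * ((s + 1 : ℕ) : ℝ)) - T (c * (s : ℕ))) := by
          refine Finset.sum_le_sum fun s _ => ?_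
          have a1 := hT (c * s) (c * (y + s)) (by positivity)
            (mul_le_mul_of_nonneg_left (by linarith [hy.1]) hc0)
          have a2 := hTmono (c * (y + s)) (c * ((s + 1 : ℕ) : ℝ))
            (mul_nonneg hc0 (add_nonneg hy.1 (Nat.cast_nonneg _)))
            (mul_le_mul_of_nonneg_left (by push_cast; linarith [hy.2]) hc0)
          linarith
      _ = T m - T 0 := by
          rw [Finset.sum_range_sub (fun s : ℕ => T (c * s))]
          congr 2
          · rw [hc]; field_simp
          · simp
  have h3 : |∫ y in (0 : ℝ)..1, ∑ s ∈ Finset.range n, (g (c * (y + s)) - g (c * s)) * h y| ≤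
      ∫ y in (0 : ℝ)..1, m * V * |h y| := by
    rw [← Real.norm_eq_abs]
    refine intervalIntegral.norm_integral_le_of_norm_le zero_le_one ?_ (hhInt.abs.const_mul _)
    refine ae_of_all _ fun y hy => ?_
    rw [← Finset.sum_mul, norm_mul]
    refine mul_le_mul_of_nonneg_right ?_ (abs_nonneg _)
    exact (Finset.abs_sum_le_sum_abs _ _).trans (hpt y ⟨hy.1.le, hy.2⟩)
  rw [intervalIntegral.integral_const_mul] at h3
  calc _ ≤ (n : ℝ)⁻¹ * (m * V * ∫ x in (0 : ℝ)..1, |h x|) :=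
        mul_le_mul_of_nonneg_left h3 (by positivity)
    _ = _ := by rw [hc]; ring

/-! ### Exponentials and trigonometric polynomials -/

/-- The exponential `x ↦ exp (2 π i j x)`. -/
noncomputable def charWave (j : ℤ) (x : ℝ) : ℂ := Complex.exp (2 * Real.pi * Complex.I * j * x)

theorem charWave_add (i j : ℤ) (x : ℝ) : charWave (i + j) x = charWave i x * charWave j x := by
  simp only [charWave, ← Complex.exp_add]
  congr 1
  push_cast
  ring

theorem charWave_zero (x : ℝ) : charWave 0 x = 1 := by simp [charWave]

theorem charWave_eq_exp_ofReal_mul_I (j : ℤ) (x : ℝ) :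
    charWave j x = Complex.exp ((2 * Real.pi * j * x : ℝ) * Complex.I) := by
  rw [charWave]
  congr 1
  push_cast
  ring

theorem norm_charWave (j : ℤ) (x : ℝ) : ‖charWave j x‖ = 1 := by
  rw [charWave_eq_exp_ofReal_mul_I, Complex.norm_exp_ofReal_mul_I]

theorem conj_charWave (j : ℤ) (x : ℝ) : conj (charWave j x) = charWave (-j) x := by
  rw [charWave_eq_exp_ofReal_mul_I, charWave_eq_exp_ofReal_mul_I, ← Complex.exp_conj]
  congr 1
  rw [map_mul, Complex.conj_ofReal, Complex.conj_I]
  push_cast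
  ring

theorem continuous_charWave (j : ℤ) : Continuous (charWave j) := by
  unfold charWave
  fun_prop

theorem charWave_comp_nat_mul (j : ℤ) (n : ℕ) (x : ℝ) :
    charWave j (n * x) = charWave (j * n) x := by
  simp only [charWave]
  congr 1
  push_cast
  ring

theorem periodic_charWave (j : ℤ) : Function.Periodic (charWave j) 1 := by
  intro x
  rw [charWave, charWave, Complex.exp_eq_exp_iff_exists_int]
  exact ⟨j, by push_cast; ring⟩

theorem integral_charWave (j : ℤ) :
    ∫ x in (0 : ℝ)..1, charWave j x = if j = 0 then 1 else 0 := by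
  split_ifs with h
  · subst h
    simp [charWave_zero]
  · have hc : (2 * Real.pi * Complex.I * j : ℂ) ≠ 0 := by
      simp [h, Real.pi_ne_zero]
    have h1 : Complex.exp (2 * Real.pi * Complex.I * j) = 1 := by
      have := periodic_charWave j 0
      simpa [charWave] using this
    simp only [charWave]
    rw [integral_exp_mul_complex hc]
    simp [h1]

/-- The trigonometric polynomials with frequencies in `S`. -/
def trigSpan (S : Set ℤ) : Submodule ℂ (ℝ → ℂ) := Submodule.span ℂ (charWave '' S)

theorem trigSpan_mono {S T : Set ℤ} (h : S ⊆ T) : trigSpan S ≤ trigSpan T :=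
  Submodule.span_mono (image_mono h)

theorem charWave_mem_trigSpan {S : Set ℤ} {j : ℤ} (h : j ∈ S) : charWave j ∈ trigSpan S :=
  Submodule.subset_span ⟨j, h, rfl⟩

theorem mul_mem_trigSpan {S T U : Set ℤ} (hU : ∀ i ∈ S, ∀ j ∈ T, i + j ∈ U) {g h : ℝ → ℂ}
    (hg : g ∈ trigSpan S) (hh : h ∈ trigSpan T) : g * h ∈ trigSpan U := by
  have h1 := Submodule.mul_mem_mul hg hh
  rw [trigSpan, trigSpan, Submodule.span_mul_span] at h1
  refine Submodule.span_mono ?_ h1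
  rintro _ ⟨_, ⟨i, hi, rfl⟩, _, ⟨j, hj, rfl⟩, rfl⟩
  exact ⟨i + j, hU i hi j hj, funext fun x => charWave_add i j x⟩

theorem continuous_of_mem_trigSpan {S : Set ℤ} {g : ℝ → ℂ} (hg : g ∈ trigSpan S) :
    Continuous g := by
  induction hg using Submodule.span_induction with
  | mem x h => obtain ⟨j, _, rfl⟩ := h; exact continuous_charWave j
  | zero => exact continuous_zero
  | add _ _ _ _ h1 h2 => exact h1.add h2
  | smul c _ _ h => exact h.const_smul c

theorem integral_eq_zero_of_mem_trigSpan {S : Set ℤ} (hS : (0 : ℤ) ∉ S) {g : ℝ → ℂ}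
    (hg : g ∈ trigSpan S) : ∫ x in (0 : ℝ)..1, g x = 0 := by
  induction hg using Submodule.span_induction with
  | mem x h =>
    obtain ⟨j, hj, rfl⟩ := h
    rw [integral_charWave, if_neg]
    rintro rfl
    exact hS hj
  | zero => simp
  | add a b ha hb h1 h2 =>
    simp only [Pi.add_apply]
    rw [intervalIntegral.integral_add ((continuous_of_mem_trigSpan ha).intervalIntegrable _ _)
      ((continuous_of_mem_trigSpan hb).intervalIntegrable _ _), h1, h2, add_zero]
  | smul c a _ h =>
    simp only [Pi.smul_apply]
    rw [intervalIntegral.integral_smul, h, smul_zero]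

/-- A dilated periodic function orthogonal to all low frequencies has no frequency below the
dilated threshold. -/
theorem integral_charWave_mul_comp_eq_zero {r : ℝ → ℝ} {M : ℝ} (hr : Measurable r)
    (hrb : ∀ x, |r x| ≤ M) (hper : Function.Periodic r 1) {d : ℤ}
    (horth : ∀ j : ℤ, |j| ≤ d → ∫ x in (0 : ℝ)..1, charWave j x * (r x : ℂ) = 0)
    {i : ℤ} {n : ℕ} (hn : 0 < n) (hi : |i| ≤ d * n) :
    ∫ x in (0 : ℝ)..1, charWave i x * (r (n * x) : ℂ) = 0 := by
  have hn' : (n : ℝ) ≠ 0 := by positivity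
  -- If `n ∣ i`, undoing the dilation leaves the frequency `i / n`, at most `d` in modulus, where
  -- `r` is orthogonal by hypothesis.
  by_cases hdvd : (n : ℤ) ∣ i
  · obtain ⟨k, rfl⟩ := hdvd
    have hk : |k| ≤ d := by
      rw [abs_mul, Nat.abs_cast, mul_comm] at hi
      exact le_of_mul_le_mul_right hi (by exact_mod_cast hn)
    rw [← horth k hk]
    have hG : Function.Periodic (fun x => charWave k x * (r x : ℂ)) 1 := fun x => by
      simp only [hper x, periodic_charWave k x]
    rw [← hG.integral_comp_nat_mul (fun a b => intervalIntegrable_of_bound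
      ((continuous_charWave k).measurable.mul
        (Complex.measurable_ofReal.comp hr)).aestronglyMeasurable M (fun x => ?_) a b) hn]
    · simp only [charWave_comp_nat_mul, mul_comm (n : ℤ) k]
    · simpa [norm_charWave] using hrb x
  -- If `n ∤ i`, a shift by `1 / n` fixes `r (n x)` and multiplies the integrand by a root of unity
  -- other than `1`; the integral over a period is shift invariant, hence zero.
  · set h : ℝ → ℂ := fun x => charWave i x * (r (n * x) : ℂ) with hh
    have hperh : Function.Periodic h 1 := fun x => by
      have h1 : r (n * (x + 1)) = r (n * x) := by
        rw [mul_add]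
        simpa using hper.nat_mul n (n * x)
      simp only [hh, h1, periodic_charWave i x]
    have hshift : ∀ x, h (x + 1 / n) = charWave i (1 / n) * h x := fun x => by
      have h1 : r (n * (x + 1 / n)) = r (n * x) := by
        rw [mul_add, mul_one_div_cancel hn', hper]
      have h2 : charWave i (x + 1 / n) = charWave i (1 / n) * charWave i x := by
        simp only [charWave, ← Complex.exp_add]
        congr 1
        push_cast
        ring
      simp only [hh, h1, h2]
      ring
    have e1 : ∫ x in (0 : ℝ)..1, h (x + 1 / n) = ∫ x in (0 : ℝ)..1, h x := by
      rw [intervalIntegral.integral_comp_add_right]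
      have := hperh.intervalIntegral_add_eq (1 / n) 0
      rw [zero_add] at this
      rw [zero_add, add_comm 1, this]
    simp only [hshift] at e1
    rw [intervalIntegral.integral_const_mul] at e1
    have hne : charWave i (1 / n) ≠ 1 := by
      intro hc
      rw [charWave, Complex.exp_eq_one_iff] at hc
      obtain ⟨k, hk⟩ := hc
      have hn'' : (n : ℂ) ≠ 0 := by exact_mod_cast hn.ne'
      have : (i : ℂ) = n * k := by
        have hpi : (2 * Real.pi * Complex.I : ℂ) ≠ 0 := by simp [Real.pi_ne_zero]
        apply mul_left_cancel₀ hpi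
        push_cast at hk
        field_simp at hk ⊢
        linear_combination hk
      exact hdvd ⟨k, by exact_mod_cast this⟩
    have : (charWave i (1 / n) - 1) * ∫ x in (0 : ℝ)..1, h x = 0 := by
      rw [sub_mul, e1, one_mul, sub_self]
    exact (mul_eq_zero.1 this).resolve_left (sub_ne_zero.2 hne)

/-! ### Fourier approximation -/

theorem intervalIntegrable_charWave_mul {f : ℝ → ℝ} {M : ℝ} (hf : Measurable f)
    (hfb : ∀ x, |f x| ≤ M) (j : ℤ) (a b : ℝ) :
    IntervalIntegrable (fun x => charWave j x * (f x : ℂ)) volume a b :=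
  intervalIntegrable_of_bound ((continuous_charWave j).measurable.mul
    (Complex.measurable_ofReal.comp hf)).aestronglyMeasurable M
    (fun x => by simpa [norm_charWave] using hfb x) a b

/-- Approximation of a bounded periodic function by its Fourier partial sums. -/
theorem exists_trigonometric_approximation {f : ℝ → ℝ} {M : ℝ} (hf : Measurable f)
    (hfb : ∀ x, |f x| ≤ M) (hmean : ∫ x in (0 : ℝ)..1, f x = 0) {ε : ℝ} (hε : 0 < ε) :
    ∃ (d : ℕ) (c : ℤ → ℂ) (p : ℝ → ℝ), c 0 = 0 ∧
      (∀ x, (p x : ℂ) = ∑ j ∈ Finset.Icc (-d : ℤ) d, c j * charWave j x) ∧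
      (∀ j : ℤ, |j| ≤ d → ∫ x in (0 : ℝ)..1, charWave j x * ((f x - p x : ℝ) : ℂ) = 0) ∧
      ∫ x in (0 : ℝ)..1, (f x - p x) ^ 2 < ε := by
  set c : ℤ → ℂ := fun j => ∫ x in (0 : ℝ)..1, charWave (-j) x * (f x : ℂ) with hc
  have hcI := intervalIntegrable_charWave_mul hf hfb
  have hconj : ∀ j, conj (c j) = c (-j) := by
    intro j
    simp only [hc]
    rw [← integral_lebesgueUnit, ← integral_lebesgueUnit, ← integral_conj]
    simp [conj_charWave]
  have hcoeff : ∀ j, fourierCoeffOn zero_lt_one (fun x => (f x : ℂ)) j = c j := by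
    intro j
    rw [fourierCoeffOn_eq_integral]
    simp only [sub_zero, div_one, one_smul, hc, smul_eq_mul]
    refine intervalIntegral.integral_congr fun x _ => ?_
    simp only [charWave, fourier_coe_apply]
    simp
  have hL2 : MemLp (fun x => (f x : ℂ)) 2 (volume.restrict (Ioc (0 : ℝ) 1)) :=
    MemLp.of_bound (Complex.measurable_ofReal.comp hf).aestronglyMeasurable M
      (ae_of_all _ fun x => by simpa using hfb x)
  have hsum := hasSum_sq_fourierCoeffOn zero_lt_one hL2
  simp only [hcoeff, sub_zero, inv_one, one_smul, Complex.norm_real, Real.norm_eq_abs,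
    sq_abs] at hsum
  have hlim : Tendsto (fun d : ℕ => Finset.Icc (-d : ℤ) d) atTop atTop := by
    refine tendsto_atTop_finset_of_monotone
      (fun a b hab => Finset.Icc_subset_Icc (by simpa using hab) (by exact_mod_cast hab))
      (fun j => ⟨j.natAbs, by simp only [Finset.mem_Icc]; omega⟩)
  -- By Parseval, some symmetric partial sum of the `‖c j‖²` exceeds `∫ f² - ε`; this fixes `d`.
  have hev := (Tendsto.comp hsum hlim).eventually_const_lt (sub_lt_self _ hε)
  obtain ⟨d, hd⟩ := hev.exists
  set J := Finset.Icc (-d : ℤ) d with hJ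
  -- The frequency set is symmetric and `c (-j)` is the conjugate of `c j`, so the partial sum is
  -- real.
  have hreal : ∀ x, ((∑ j ∈ J, c j * charWave j x).re : ℂ) = ∑ j ∈ J, c j * charWave j x := by
    intro x
    rw [← Complex.conj_eq_iff_re, map_sum]
    refine Finset.sum_equiv (Equiv.neg ℤ) (fun j => ?_) (fun j _ => ?_)
    · simp only [hJ, Finset.mem_Icc, Equiv.neg_apply]; omega
    · simp [hconj, conj_charWave]
  set p : ℝ → ℝ := fun x => (∑ j ∈ J, c j * charWave j x).re with hp
  have hpc : Continuous p := Complex.continuous_re.comp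
    (continuous_finsetSum _ fun j _ => continuous_const.mul (continuous_charWave j))
  have hpI : ∀ j, IntervalIntegrable (fun x => charWave j x * (p x : ℂ)) volume 0 1 := fun j =>
    ((continuous_charWave j).mul (Complex.continuous_ofReal.comp hpc)).intervalIntegrable _ _
  have hpcoef : ∀ j ∈ J, ∫ x in (0 : ℝ)..1, charWave j x * (p x : ℂ) = c (-j) := by
    intro j hj
    have : ∀ x, charWave j x * (p x : ℂ) = ∑ i ∈ J, c i * charWave (j + i) x := fun x => by
      rw [hreal, Finset.mul_sum]
      exact Finset.sum_congr rfl fun i _ => by rw [charWave_add]; ring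
    simp only [this]
    rw [intervalIntegral.integral_finsetSum fun i _ =>
      ((continuous_charWave _).intervalIntegrable _ _).const_mul _]
    simp only [intervalIntegral.integral_const_mul, integral_charWave]
    rw [Finset.sum_eq_single (-j)]
    · simp
    · intro i _ hi
      rw [if_neg (by omega), mul_zero]
    · intro h
      exfalso
      apply h
      simp only [hJ, Finset.mem_Icc] at hj ⊢
      omega
  have horth : ∀ j ∈ J, ∫ x in (0 : ℝ)..1, charWave j x * ((f x - p x : ℝ) : ℂ) = 0 := by
    intro j hj
    simp only [Complex.ofReal_sub, mul_sub]
    rw [intervalIntegral.integral_sub (hcI j _ _) (hpI j), hpcoef j hj]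
    simp [hc]
  refine ⟨d, c, p, ?_, hreal, fun j hj => horth j ?_, ?_⟩
  · simp [hc, charWave_zero, intervalIntegral.integral_ofReal, hmean]
  · simp only [hJ, Finset.mem_Icc]
    exact abs_le.1 hj
  · have hrI : ∀ j, IntervalIntegrable (fun x => charWave j x * ((f x - p x : ℝ) : ℂ))
        volume 0 1 := fun j => by
      simp only [Complex.ofReal_sub, mul_sub]
      exact (hcI j _ _).sub (hpI j)
    have hfI : IntervalIntegrable f volume 0 1 :=
      intervalIntegrable_of_bound hf.aestronglyMeasurable M hfb _ _
    have hrp : ∫ x in (0 : ℝ)..1, (p x : ℂ) * ((f x - p x : ℝ) : ℂ) = 0 := by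
      have : ∀ x, (p x : ℂ) * ((f x - p x : ℝ) : ℂ) =
          ∑ j ∈ J, c j * (charWave j x * ((f x - p x : ℝ) : ℂ)) := fun x => by
        rw [hreal, Finset.sum_mul]
        exact Finset.sum_congr rfl fun i _ => by ring
      simp only [this]
      rw [intervalIntegral.integral_finsetSum fun i _ => (hrI i).const_mul _]
      refine Finset.sum_eq_zero fun j hj => ?_
      rw [intervalIntegral.integral_const_mul, horth j hj, mul_zero]
    have hfp : ∫ x in (0 : ℝ)..1, (p x : ℂ) * (f x : ℂ) = ∑ j ∈ J, ((‖c j‖ ^ 2 : ℝ) : ℂ) := by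
      have : ∀ x, (p x : ℂ) * (f x : ℂ) =
          ∑ j ∈ J, c j * (charWave j x * (f x : ℂ)) := fun x => by
        rw [hreal, Finset.sum_mul]
        exact Finset.sum_congr rfl fun i _ => by ring
      simp only [this]
      rw [intervalIntegral.integral_finsetSum fun i _ => (hcI i _ _).const_mul _]
      refine Finset.sum_congr rfl fun j hj => ?_
      rw [intervalIntegral.integral_const_mul]
      have h1 : ∫ x in (0 : ℝ)..1, charWave j x * (f x : ℂ) = conj (c j) := by
        rw [hconj]; simp [hc]
      rw [h1, Complex.mul_conj, Complex.normSq_eq_norm_sq]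
    have hrp' : ∫ x in (0 : ℝ)..1, p x * (f x - p x) = 0 := by
      have := hrp
      rw [← Complex.ofReal_inj, ← intervalIntegral.integral_ofReal]
      simpa using this
    have hfp' : ∫ x in (0 : ℝ)..1, p x * f x = ∑ j ∈ J, ‖c j‖ ^ 2 := by
      rw [← Complex.ofReal_inj, ← intervalIntegral.integral_ofReal]
      simpa using hfp
    have hpfI : IntervalIntegrable (fun x => p x * f x) volume 0 1 :=
      hfI.continuousOn_mul hpc.continuousOn
    have hppI : IntervalIntegrable (fun x => p x * p x) volume 0 1 :=
      (hpc.mul hpc).intervalIntegrable _ _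
    have hffI : IntervalIntegrable (fun x => f x ^ 2) volume 0 1 :=
      intervalIntegrable_of_bound (hf.pow_const 2).aestronglyMeasurable (M ^ 2) (fun x => by
        rw [norm_pow]
        exact pow_le_pow_left₀ (norm_nonneg _) (hfb x) 2) _ _
    -- The last term integrates to zero by orthogonality, and `∫ p f` is the partial Parseval sum.
    have e1 : ∀ x, (f x - p x) ^ 2 = f x ^ 2 - p x * f x - p x * (f x - p x) := fun x => by ring
    simp only [e1]
    rw [intervalIntegral.integral_sub (hffI.sub hpfI), intervalIntegral.integral_sub hffI hpfI,
      hrp', hfp']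
    · simp only [Function.comp_apply] at hd
      linarith
    · simpa only [mul_sub] using hpfI.sub hppI

/-! ### Product approximation of characteristic functions -/

theorem norm_one_add_mul_I_le (x : ℝ) : ‖(1 + x * Complex.I : ℂ)‖ ≤ Real.exp (x ^ 2 / 2) := by
  have h : ‖(1 + x * Complex.I : ℂ)‖ ^ 2 = 1 + x ^ 2 := by
    rw [← Complex.normSq_eq_norm_sq, Complex.normSq_apply]
    simp
    ring
  refine le_of_sq_le_sq ?_ (Real.exp_pos _).le
  rw [h, ← Real.exp_nat_mul]
  have := Real.add_one_le_exp (x ^ 2)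
  rw [show ((2 : ℕ) : ℝ) * (x ^ 2 / 2) = x ^ 2 by push_cast; ring]
  linarith

/-- Membership of each factor in the unit disc is what lets the errors of a product add up rather
than multiply. -/
theorem norm_one_add_mul_I_mul_exp_le (x : ℝ) :
    ‖(1 + x * Complex.I) * (Real.exp (-(x ^ 2 / 2)) : ℂ)‖ ≤ 1 := by
  rw [norm_mul, Complex.norm_real, Real.norm_eq_abs, Real.abs_exp, Real.exp_neg,
    ← div_eq_mul_inv, div_le_one (Real.exp_pos _)]
  exact norm_one_add_mul_I_le x

theorem norm_exp_mul_I_sub_le (x : ℝ) :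
    ‖Complex.exp (x * Complex.I) - (1 + x * Complex.I) * (Real.exp (-(x ^ 2 / 2)) : ℂ)‖ ≤
      4 * |x| ^ 3 := by
  -- For `|x| ≤ 1` both terms are compared with `1 + ix - x²/2`; the errors add up to `(1 + 1 + 2)
  -- |x|³`. For `|x| ≥ 1` both have modulus at most `1`.
  rcases le_total |x| 1 with hx | hx
  · have h1 : ‖Complex.exp (x * Complex.I) - (1 + x * Complex.I - x ^ 2 / 2)‖ ≤ |x| ^ 3 := by
      have hb : ‖(x * Complex.I : ℂ)‖ = |x| := by simp
      have := Complex.exp_bound (x := x * Complex.I) (hb.trans_le hx) (n := 3) (by norm_num)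
      rw [hb] at this
      simp only [Finset.sum_range_succ, Finset.sum_range_zero] at this
      have e : (0 + (x * Complex.I : ℂ) ^ 0 / (Nat.factorial 0 : ℂ) +
          (x * Complex.I : ℂ) ^ 1 / (Nat.factorial 1 : ℂ) +
          (x * Complex.I : ℂ) ^ 2 / (Nat.factorial 2 : ℂ)) =
          1 + x * Complex.I - x ^ 2 / 2 := by
        have hI : (x * Complex.I : ℂ) ^ 2 = -x ^ 2 := by rw [mul_pow, Complex.I_sq]; ring
        rw [hI]
        simp [Nat.factorial]
        ring
      rw [e] at this
      refine this.trans ?_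
      have h3 : (0 : ℝ) ≤ |x| ^ 3 := by positivity
      norm_num [Nat.factorial]
      linarith
    have h2 : |Real.exp (-(x ^ 2 / 2)) - (1 - x ^ 2 / 2)| ≤ |x| ^ 3 := by
      have hx2 : x ^ 2 ≤ 1 := by
        rw [← sq_abs]; exact pow_le_one₀ (abs_nonneg _) hx
      have hy : |-(x ^ 2 / 2)| ≤ 1 := by
        rw [abs_neg, abs_of_nonneg (by positivity)]; linarith
      have := Real.abs_exp_sub_one_sub_id_le hy
      have e : Real.exp (-(x ^ 2 / 2)) - 1 - -(x ^ 2 / 2) =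
        Real.exp (-(x ^ 2 / 2)) - (1 - x ^ 2 / 2) := by ring
      rw [e] at this
      refine this.trans ?_
      have e2 : (-(x ^ 2 / 2)) ^ 2 = |x| ^ 3 * |x| / 4 := by
        have : |x| ^ 3 * |x| = (|x| ^ 2) ^ 2 := by ring
        rw [this, sq_abs]; ring
      rw [e2]
      have h3 : (0 : ℝ) ≤ |x| ^ 3 := by positivity
      nlinarith [abs_nonneg x]
    have h4 : ‖(1 + x * Complex.I : ℂ)‖ ≤ 2 := by
      refine (norm_add_le _ _).trans ?_
      simp
      linarith
    have h5 : ‖((1 + x * Complex.I) * (1 - x ^ 2 / 2) - (1 + x * Complex.I - x ^ 2 / 2) : ℂ)‖ ≤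
        |x| ^ 3 := by
      have : ((1 + x * Complex.I) * (1 - x ^ 2 / 2) - (1 + x * Complex.I - x ^ 2 / 2) : ℂ) =
        -(x ^ 3 * Complex.I / 2) := by ring
      rw [this]
      simp only [norm_neg, norm_div, norm_mul, norm_pow, Complex.norm_real, Complex.norm_I,
        Real.norm_eq_abs, mul_one]
      have h3 : (0 : ℝ) ≤ |x| ^ 3 := by positivity
      norm_num
    have h6 : ‖((Real.exp (-(x ^ 2 / 2)) : ℂ) - (1 - x ^ 2 / 2))‖ ≤ |x| ^ 3 := by
      have : ((Real.exp (-(x ^ 2 / 2)) : ℂ) - (1 - x ^ 2 / 2)) =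
        ((Real.exp (-(x ^ 2 / 2)) - (1 - x ^ 2 / 2) : ℝ) : ℂ) := by push_cast; rfl
      rw [this, Complex.norm_real]
      exact h2
    calc _ = ‖(Complex.exp (x * Complex.I) - (1 + x * Complex.I - x ^ 2 / 2)) -
          ((1 + x * Complex.I) * (1 - x ^ 2 / 2) - (1 + x * Complex.I - x ^ 2 / 2)) -
          (1 + x * Complex.I) * ((Real.exp (-(x ^ 2 / 2)) : ℂ) - (1 - x ^ 2 / 2))‖ := by
          congr 1; ring
      _ ≤ |x| ^ 3 + |x| ^ 3 + 2 * |x| ^ 3 := by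
          refine (norm_sub_le _ _).trans (add_le_add ((norm_sub_le _ _).trans
            (add_le_add h1 h5)) ?_)
          rw [norm_mul]
          exact mul_le_mul h4 h6 (norm_nonneg _) (by norm_num)
      _ = _ := by ring
  · calc _ ≤ ‖Complex.exp (x * Complex.I)‖ +
          ‖(1 + x * Complex.I) * (Real.exp (-(x ^ 2 / 2)) : ℂ)‖ := norm_sub_le _ _
      _ ≤ 1 + 1 := add_le_add (Complex.norm_exp_ofReal_mul_I x).le
          (norm_one_add_mul_I_mul_exp_le x)
      _ ≤ _ := by nlinarith [one_le_pow₀ hx (n := 3)]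

theorem norm_prod_sub_prod_le_sum {ι : Type*} (s : Finset ι) {a b : ι → ℂ}
    (ha : ∀ i ∈ s, ‖a i‖ ≤ 1) (hb : ∀ i ∈ s, ‖b i‖ ≤ 1) :
    ‖∏ i ∈ s, a i - ∏ i ∈ s, b i‖ ≤ ∑ i ∈ s, ‖a i - b i‖ := by
  classical
  induction s using Finset.induction_on with
  | empty => simp
  | insert i s hi ih =>
    rw [Finset.prod_insert hi, Finset.prod_insert hi, Finset.sum_insert hi]
    have e : a i * ∏ j ∈ s, a j - b i * ∏ j ∈ s, b j =
      (a i - b i) * ∏ j ∈ s, a j + b i * (∏ j ∈ s, a j - ∏ j ∈ s, b j) := by ring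
    rw [e]
    have hp : ‖∏ j ∈ s, a j‖ ≤ 1 := by
      rw [norm_prod]
      exact Finset.prod_le_one (fun _ _ => norm_nonneg _)
        fun j hj => ha j (Finset.mem_insert_of_mem hj)
    refine (norm_add_le _ _).trans (add_le_add ?_ ?_)
    · rw [norm_mul]
      exact mul_le_of_le_one_right (norm_nonneg _) hp
    · rw [norm_mul]
      exact (mul_le_of_le_one_left (norm_nonneg _) (hb i (Finset.mem_insert_self _ _))).trans
        (ih (fun j hj => ha j (Finset.mem_insert_of_mem hj))
          fun j hj => hb j (Finset.mem_insert_of_mem hj))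

theorem norm_exp_sum_sub_prod_le {ι : Type*} (s : Finset ι) (x : ι → ℝ) :
    ‖Complex.exp ((∑ i ∈ s, x i : ℝ) * Complex.I) -
      (∏ i ∈ s, (1 + x i * Complex.I)) * (Real.exp (-((∑ i ∈ s, x i ^ 2) / 2)) : ℂ)‖ ≤
      4 * ∑ i ∈ s, |x i| ^ 3 := by
  have e1 : Complex.exp ((∑ i ∈ s, x i : ℝ) * Complex.I) =
      ∏ i ∈ s, Complex.exp (x i * Complex.I) := by
    rw [← Complex.exp_sum, Complex.ofReal_sum, Finset.sum_mul]
  have e2 : (Real.exp (-((∑ i ∈ s, x i ^ 2) / 2)) : ℂ) =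
      ∏ i ∈ s, (Real.exp (-(x i ^ 2 / 2)) : ℂ) := by
    rw [← Complex.ofReal_prod, ← Real.exp_sum, Finset.sum_div, Finset.sum_neg_distrib]
  rw [e1, e2, ← Finset.prod_mul_distrib, Finset.mul_sum]
  refine (norm_prod_sub_prod_le_sum s (fun i _ => (Complex.norm_exp_ofReal_mul_I _).le)
    fun i _ => norm_one_add_mul_I_mul_exp_le _).trans ?_
  exact Finset.sum_le_sum fun i _ => norm_exp_mul_I_sub_le _

theorem norm_prod_one_add_mul_I_le {ι : Type*} (s : Finset ι) (x : ι → ℝ) :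
    ‖∏ i ∈ s, (1 + x i * Complex.I : ℂ)‖ ≤ Real.exp ((∑ i ∈ s, x i ^ 2) / 2) := by
  rw [norm_prod, Finset.sum_div, Real.exp_sum]
  exact Finset.prod_le_prod (fun _ _ => norm_nonneg _) fun i _ => norm_one_add_mul_I_le _

theorem abs_exp_neg_half_sub_le {a b : ℝ} (ha : 0 ≤ a) (hb : 0 ≤ b) :
    |Real.exp (-(a / 2)) - Real.exp (-(b / 2))| ≤ |a - b| := by
  wlog h : a ≤ b generalizing a b
  · rw [abs_sub_comm, abs_sub_comm a b]
    exact this hb ha (le_of_not_ge h)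
  have h1 : Real.exp (-(b / 2)) = Real.exp (-(a / 2)) * Real.exp (-((b - a) / 2)) := by
    rw [← Real.exp_add]; congr 1; ring
  have h2 := Real.add_one_le_exp (-((b - a) / 2))
  have h3 : Real.exp (-(a / 2)) ≤ 1 := Real.exp_le_one_iff.2 (by linarith)
  have h4 := Real.exp_pos (-(a / 2))
  have h5 : Real.exp (-((b - a) / 2)) ≤ 1 := Real.exp_le_one_iff.2 (by linarith)
  rw [abs_of_nonneg, abs_of_nonpos (by linarith)]
  · nlinarith
  · nlinarith

/-- Characteristic functions of sums whose multiplicative expansion integrates to `1` and whose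
sum of squares is nearly constant. -/
theorem norm_integral_exp_sub_le {ι : Type*} (s : Finset ι) {X : ι → ℝ → ℝ}
    (hX : ∀ i, Continuous (X i)) {A δ v : ℝ} (hv : 0 ≤ v)
    (hA : ∀ x, ∑ i ∈ s, X i x ^ 2 ≤ A) (hδ : ∀ x, ∑ i ∈ s, |X i x| ^ 3 ≤ δ)
    (hprod : ∫ x in (0 : ℝ)..1, ∏ i ∈ s, (1 + X i x * Complex.I : ℂ) = 1) :
    ‖(∫ x in (0 : ℝ)..1, Complex.exp ((∑ i ∈ s, X i x : ℝ) * Complex.I)) -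
      (Real.exp (-(v / 2)) : ℂ)‖ ≤
      4 * δ + Real.exp (A / 2) * ∫ x in (0 : ℝ)..1, |∑ i ∈ s, X i x ^ 2 - v| := by
  have hc1 : Continuous fun x => ∏ i ∈ s, (1 + X i x * Complex.I : ℂ) := by fun_prop
  have hc2 : Continuous fun x => Complex.exp ((∑ i ∈ s, X i x : ℝ) * Complex.I) := by fun_prop
  -- Since the product has integral `1`, the Gaussian factor can be written as the integral of the
  -- product times a constant.
  have e : (∫ x in (0 : ℝ)..1, Complex.exp ((∑ i ∈ s, X i x : ℝ) * Complex.I)) -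
      (Real.exp (-(v / 2)) : ℂ) =
      ∫ x in (0 : ℝ)..1, (Complex.exp ((∑ i ∈ s, X i x : ℝ) * Complex.I) -
        (∏ i ∈ s, (1 + X i x * Complex.I : ℂ)) * (Real.exp (-(v / 2)) : ℂ)) := by
    rw [intervalIntegral.integral_sub (hc2.intervalIntegrable _ _)
      ((hc1.intervalIntegrable _ _).mul_const _), intervalIntegral.integral_mul_const,
      hprod, one_mul]
  have hc3 : Continuous fun x => |∑ i ∈ s, X i x ^ 2 - v| := by fun_prop
  have e2 : 4 * δ + Real.exp (A / 2) * ∫ x in (0 : ℝ)..1, |∑ i ∈ s, X i x ^ 2 - v| =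
      ∫ x in (0 : ℝ)..1, (4 * δ + Real.exp (A / 2) * |∑ i ∈ s, X i x ^ 2 - v|) := by
    rw [intervalIntegral.integral_add intervalIntegrable_const
      ((hc3.intervalIntegrable _ _).const_mul _), intervalIntegral.integral_const_mul]
    simp
  rw [e, e2]
  refine intervalIntegral.norm_integral_le_of_norm_le zero_le_one (ae_of_all _ fun x _ => ?_)
    ((continuous_const.add (continuous_const.mul hc3)).intervalIntegrable _ _)
  set P := ∏ i ∈ s, (1 + X i x * Complex.I : ℂ)
  set w := ∑ i ∈ s, X i x ^ 2 with hw
  have hw0 : 0 ≤ w := Finset.sum_nonneg fun i _ => sq_nonneg _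
  calc _ = ‖(Complex.exp ((∑ i ∈ s, X i x : ℝ) * Complex.I) - P * (Real.exp (-(w / 2)) : ℂ)) +
        P * ((Real.exp (-(w / 2)) - Real.exp (-(v / 2)) : ℝ) : ℂ)‖ := by
        congr 1; push_cast; ring
    _ ≤ _ := by
      refine (norm_add_le _ _).trans (add_le_add ((norm_exp_sum_sub_prod_le s _).trans
        (mul_le_mul_of_nonneg_left (hδ x) (by norm_num))) ?_)
      rw [norm_mul, Complex.norm_real]
      refine mul_le_mul ((norm_prod_one_add_mul_I_le s _).trans (Real.exp_le_exp.2 ?_))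
        (abs_exp_neg_half_sub_le hw0 hv) (norm_nonneg _) (Real.exp_pos _).le
      linarith [hA x]

/-! ### Separated frequency bands -/

/-- Products of trigonometric polynomials whose frequencies lie in well separated bands. -/
theorem prod_one_add_sub_one_mem_trigSpan {X : ℕ → ℝ → ℂ} {D : ℕ → ℤ} (hD0 : 0 ≤ D 0)
    (hD : Monotone D)
    (hX : ∀ b, X b ∈ trigSpan {ω | D b < |ω| ∧ D b + |ω| ≤ D (b + 1)}) (N : ℕ) :
    (∏ b ∈ Finset.range N, (1 + X b)) - 1 ∈ trigSpan {ω | 0 < |ω| ∧ |ω| ≤ D N} := by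
  have hDn : ∀ b, 0 ≤ D b := fun b => hD0.trans (hD (Nat.zero_le b))
  induction N with
  | zero => simp
  | succ N ih =>
    rw [Finset.prod_range_succ]
    have e : (∏ b ∈ Finset.range N, (1 + X b)) * (1 + X N) - 1 =
      ((∏ b ∈ Finset.range N, (1 + X b)) - 1) + X N +
        ((∏ b ∈ Finset.range N, (1 + X b)) - 1) * X N := by ring
    rw [e]
    refine add_mem (add_mem (trigSpan_mono ?_ ih) (trigSpan_mono ?_ (hX N)))
      (mul_mem_trigSpan ?_ ih (hX N))
    · rintro ω ⟨h1, h2⟩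
      exact ⟨h1, h2.trans (hD (Nat.le_succ N))⟩
    · rintro ω ⟨h1, h2⟩
      have := hDn N
      exact ⟨by omega, by omega⟩
    -- Here `|i| ≤ D N < |j|`, so `i + j ≠ 0`, while `|i + j| ≤ D N + |j| ≤ D (N + 1)`.
    · rintro i ⟨h1, h2⟩ j ⟨h3, h4⟩
      have h5 := abs_add_le i j
      have h6 := abs_sub_abs_le_abs_sub j (-i)
      rw [abs_neg, sub_neg_eq_add, add_comm j i] at h6
      exact ⟨by omega, by omega⟩

theorem integral_prod_one_add_eq_one {X : ℕ → ℝ → ℂ} {D : ℕ → ℤ} (hD0 : 0 ≤ D 0)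
    (hD : Monotone D)
    (hX : ∀ b, X b ∈ trigSpan {ω | D b < |ω| ∧ D b + |ω| ≤ D (b + 1)}) (N : ℕ) :
    ∫ x in (0 : ℝ)..1, ∏ b ∈ Finset.range N, (1 + X b x) = 1 := by
  have hmem := prod_one_add_sub_one_mem_trigSpan hD0 hD hX N
  have h0 := integral_eq_zero_of_mem_trigSpan (by simp) hmem
  have hc := continuous_of_mem_trigSpan hmem
  have e : ∀ x, ∏ b ∈ Finset.range N, (1 + X b x) =
      ((∏ b ∈ Finset.range N, (1 + X b)) - 1) x + 1 := fun x => by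
    simp [Finset.prod_apply]
  simp only [e]
  rw [intervalIntegral.integral_add (hc.intervalIntegrable _ _) intervalIntegrable_const, h0]
  simp

/-- A frequency of the lower band has modulus at most `D (a + 1) ≤ D b`, below every modulus in the
higher band, so no two cancel. -/
theorem integral_mul_eq_zero_of_lt {X : ℕ → ℝ → ℂ} {D : ℕ → ℤ} (hD0 : 0 ≤ D 0)
    (hD : Monotone D)
    (hX : ∀ b, X b ∈ trigSpan {ω | D b < |ω| ∧ D b + |ω| ≤ D (b + 1)}) {a b : ℕ} (hab : a < b) :
    ∫ x in (0 : ℝ)..1, X a x * X b x = 0 := by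
  have hDn : ∀ b, 0 ≤ D b := fun b => hD0.trans (hD (Nat.zero_le b))
  refine integral_eq_zero_of_mem_trigSpan (S := {0}ᶜ) (by simp)
    (mul_mem_trigSpan (fun i hi j hj => ?_) (hX a) (hX b))
  obtain ⟨h1, h2⟩ := hi
  obtain ⟨h3, h4⟩ := hj
  have h5 : D (a + 1) ≤ D b := hD hab
  have h6 := hDn a
  simp only [mem_compl_iff, mem_singleton_iff]
  intro h
  have : i = -j := by omega
  rw [this, abs_neg] at h2
  omega

/-! ### Mean-square estimates -/

/-- Cauchy–Schwarz on a space of mass one: the variance of `|u|` is nonnegative. -/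
theorem sq_integral_abs_le {u : ℝ → ℝ} (hu : IntervalIntegrable u volume 0 1)
    (hu2 : IntervalIntegrable (fun x => u x ^ 2) volume 0 1) :
    (∫ x in (0 : ℝ)..1, |u x|) ^ 2 ≤ ∫ x in (0 : ℝ)..1, u x ^ 2 := by
  set c := ∫ x in (0 : ℝ)..1, |u x| with hc
  have h : 0 ≤ ∫ x in (0 : ℝ)..1, (|u x| - c) ^ 2 :=
    intervalIntegral.integral_nonneg zero_le_one fun x _ => sq_nonneg _
  have e : ∀ x, (|u x| - c) ^ 2 = u x ^ 2 - 2 * c * |u x| + c ^ 2 := fun x => by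
    rw [sub_sq, sq_abs]; ring
  simp only [e] at h
  rw [intervalIntegral.integral_add (hu2.sub (hu.abs.const_mul _)) intervalIntegrable_const,
    intervalIntegral.integral_sub hu2 (hu.abs.const_mul _),
    intervalIntegral.integral_const_mul, ← hc] at h
  simp at h
  nlinarith

/-- Mean square of an exponential sum in terms of the multiplicity of its frequencies. -/
theorem integral_norm_sq_sum_charWave_le {ι : Type*} (Θ : Finset ι) (a : ι → ℂ) (ω : ι → ℤ)
    {A : ℝ} {κ : ℕ} (hA : ∀ τ ∈ Θ, ‖a τ‖ ≤ A)
    (hκ : ∀ τ ∈ Θ, (Θ.filter fun τ' => ω τ' = ω τ).card ≤ κ) :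
    ∫ x in (0 : ℝ)..1, ‖∑ τ ∈ Θ, a τ * charWave (ω τ) x‖ ^ 2 ≤ A ^ 2 * κ * Θ.card := by
  have e : ∀ x, ((‖∑ τ ∈ Θ, a τ * charWave (ω τ) x‖ ^ 2 : ℝ) : ℂ) =
      ∑ τ ∈ Θ, ∑ τ' ∈ Θ, a τ * conj (a τ') * charWave (ω τ - ω τ') x := by
    intro x
    rw [← Complex.normSq_eq_norm_sq, ← Complex.mul_conj, map_sum, Finset.sum_mul_sum]
    refine Finset.sum_congr rfl fun τ _ => Finset.sum_congr rfl fun τ' _ => ?_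
    rw [map_mul, conj_charWave, sub_eq_add_neg, charWave_add]
    ring
  have hI : ∀ (z : ℂ) j, IntervalIntegrable (fun x => z * charWave j x) volume 0 1 := fun z j =>
    (continuous_const.mul (continuous_charWave j)).intervalIntegrable _ _
  -- Only pairs of equal frequencies survive integration, and each index has at most `κ` partners.
  have e2 : ((∫ x in (0 : ℝ)..1, ‖∑ τ ∈ Θ, a τ * charWave (ω τ) x‖ ^ 2 : ℝ) : ℂ) =
      ∑ τ ∈ Θ, ∑ τ' ∈ Θ, a τ * conj (a τ') * if ω τ' = ω τ then 1 else 0 := by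
    rw [← intervalIntegral.integral_ofReal]
    simp only [e]
    rw [intervalIntegral.integral_finsetSum fun τ _ => by
      have := IntervalIntegrable.sum Θ (f := fun τ' x =>
        a τ * conj (a τ') * charWave (ω τ - ω τ') x) (fun τ' _ => hI _ _)
      simpa only [Finset.sum_fn] using this]
    refine Finset.sum_congr rfl fun τ _ => ?_
    rw [intervalIntegral.integral_finsetSum fun τ' _ => hI _ _]
    refine Finset.sum_congr rfl fun τ' _ => ?_
    rw [intervalIntegral.integral_const_mul, integral_charWave]
    congr 2
    rw [eq_iff_iff]
    omega
  have h0 : 0 ≤ ∫ x in (0 : ℝ)..1, ‖∑ τ ∈ Θ, a τ * charWave (ω τ) x‖ ^ 2 :=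
    intervalIntegral.integral_nonneg zero_le_one fun x _ => by positivity
  rw [← abs_of_nonneg h0, ← Real.norm_eq_abs, ← Complex.norm_real, e2]
  calc _ ≤ ∑ τ ∈ Θ, A ^ 2 * κ := by
        refine norm_sum_le_of_le _ fun τ hτ => ?_
        have hA0 : 0 ≤ A := (norm_nonneg _).trans (hA τ hτ)
        calc ‖∑ τ' ∈ Θ, a τ * conj (a τ') * if ω τ' = ω τ then 1 else 0‖
            ≤ ∑ τ' ∈ Θ, A ^ 2 * (if ω τ' = ω τ then 1 else 0) := by
              refine norm_sum_le_of_le _ fun τ' hτ' => ?_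
              rw [norm_mul, norm_mul, RCLike.norm_conj, sq]
              refine mul_le_mul (mul_le_mul (hA _ hτ) (hA _ hτ') (norm_nonneg _) hA0) ?_
                (norm_nonneg _) (by positivity)
              split_ifs <;> simp
          _ = A ^ 2 * (Θ.filter fun τ' => ω τ' = ω τ).card := by
              rw [← Finset.mul_sum, Finset.sum_boole]
          _ ≤ A ^ 2 * κ := by
              gcongr
              exact hκ τ hτ
    _ = _ := by rw [Finset.sum_const, nsmul_eq_mul]; ring

/-! ### Trigonometric polynomials along lacunary sequences -/

/-- Sequences of positive integers with gap ratio `q` whose two-term linear equations have at most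
`K a b` solutions. -/
structure LacunaryB2 (q : ℝ) (K : ℤ → ℤ → ℕ) (m : ℕ → ℕ) : Prop where
  pos : ∀ i, 0 < m i
  gap : ∀ i, q * m i ≤ m (i + 1)
  count : ∀ a b : ℤ, a ≠ 0 → b ≠ 0 → ∀ c : ℤ, c ≠ 0 →
    {p : ℕ × ℕ | a * (m p.1 : ℤ) + b * (m p.2 : ℤ) = c}.encard ≤ K a b

namespace LacunaryB2

variable {q : ℝ} {K : ℤ → ℤ → ℕ} {m : ℕ → ℕ}

theorem pow_mul_le (h : LacunaryB2 q K m) (hq : 1 < q) (i k : ℕ) : q ^ k * m i ≤ m (i + k) := by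
  induction k with
  | zero => simp
  | succ k ih =>
    calc q ^ (k + 1) * m i = q * (q ^ k * m i) := by ring
      _ ≤ q * m (i + k) := mul_le_mul_of_nonneg_left ih (by linarith)
      _ ≤ _ := h.gap (i + k)

theorem strictMono (h : LacunaryB2 q K m) (hq : 1 < q) : StrictMono m := by
  refine strictMono_nat_of_lt_succ fun i => ?_
  have h1 := h.gap i
  have h2 : (0 : ℝ) < m i := by exact_mod_cast h.pos i
  have : (m i : ℝ) < m (i + 1) := by nlinarith
  exact_mod_cast this

end LacunaryB2

/-- The real function `p` is the trigonometric polynomial of degree at most `d` with coefficients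
`c` and without constant term. -/
def IsTrigPoly (d : ℕ) (c : ℤ → ℂ) (p : ℝ → ℝ) : Prop :=
  ∀ x, (p x : ℂ) = ∑ j ∈ (Finset.Icc (-d : ℤ) d).erase 0, c j * charWave j x

namespace IsTrigPoly

variable {d : ℕ} {c : ℤ → ℂ} {p : ℝ → ℝ} {A : ℝ}

theorem continuous (hp : IsTrigPoly d c p) : Continuous p := by
  have : p = fun x => (∑ j ∈ (Finset.Icc (-d : ℤ) d).erase 0, c j * charWave j x).re := by
    funext x
    rw [← hp x, Complex.ofReal_re]
  rw [this]
  exact Complex.continuous_re.comp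
    (continuous_finsetSum _ fun j _ => continuous_const.mul (continuous_charWave j))

theorem abs_apply_le (hp : IsTrigPoly d c p)
    (hA : ∑ j ∈ (Finset.Icc (-d : ℤ) d).erase 0, ‖c j‖ ≤ A) (x : ℝ) : |p x| ≤ A := by
  rw [← Real.norm_eq_abs, ← Complex.norm_real, hp x]
  refine (norm_sum_le_of_le _ fun j _ => ?_).trans hA
  rw [norm_mul, norm_charWave, mul_one]

theorem comp_natCast_mul (hp : IsTrigPoly d c p) (n : ℕ) (x : ℝ) :
    (p (n * x) : ℂ) = ∑ j ∈ (Finset.Icc (-d : ℤ) d).erase 0, c j * charWave (j * n) x := by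
  rw [hp]
  simp only [charWave_comp_nat_mul]

theorem norm_coeff_le (hA : ∑ j ∈ (Finset.Icc (-d : ℤ) d).erase 0, ‖c j‖ ≤ A) {j : ℤ}
    (hj : j ∈ (Finset.Icc (-d : ℤ) d).erase 0) : ‖c j‖ ≤ A :=
  (Finset.single_le_sum (fun _ _ => norm_nonneg _) hj).trans hA

/-- For each nonzero `j` the value `j * m i` determines `i`, so a frequency occurs at most once per
`j`. Injectivity of `m` alone suffices, which allows arbitrary index sets such as the gaps between
blocks. -/
theorem integral_sq_sum_le (hp : IsTrigPoly d c p)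
    (hA : ∑ j ∈ (Finset.Icc (-d : ℤ) d).erase 0, ‖c j‖ ≤ A) {m : ℕ → ℕ}
    (hm : Function.Injective m) (I : Finset ℕ) :
    ∫ x in (0 : ℝ)..1, (∑ i ∈ I, p (m i * x)) ^ 2 ≤
      A ^ 2 * (((Finset.Icc (-d : ℤ) d).erase 0).card : ℝ) ^ 2 * I.card := by
  set J := (Finset.Icc (-d : ℤ) d).erase 0 with hJ
  have h := integral_norm_sq_sum_charWave_le (I ×ˢ J) (fun τ => c τ.2)
    (fun τ => τ.2 * (m τ.1 : ℤ)) (A := A) (κ := J.card) (fun τ hτ => by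
      exact norm_coeff_le hA (Finset.mem_product.1 hτ).2) (fun τ hτ => by
      refine Finset.card_le_card_of_injOn Prod.snd (fun τ' hτ' => ?_) ?_
      · exact (Finset.mem_product.1 (Finset.mem_filter.1 hτ').1).2
      · rintro ⟨i, j⟩ h1 ⟨i', j'⟩ h2 (h3 : j = j')
        subst h3
        have h1' := Finset.mem_filter.1 h1
        have h2' := Finset.mem_filter.1 h2
        have hj : j ≠ 0 := (Finset.mem_erase.1 (Finset.mem_product.1 h1'.1).2).1
        have h4 := h1'.2.trans h2'.2.symm
        have h5 := mul_left_cancel₀ hj h4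
        rw [hm (by exact_mod_cast h5 : m i = m i')])
  rw [Finset.card_product] at h
  calc _ = ∫ x in (0 : ℝ)..1, ‖∑ τ ∈ I ×ˢ J, c τ.2 * charWave (τ.2 * (m τ.1 : ℤ)) x‖ ^ 2 := by
        refine intervalIntegral.integral_congr fun x _ => ?_
        rw [← sq_abs, ← Real.norm_eq_abs, ← Complex.norm_real, Complex.ofReal_sum,
          Finset.sum_product]
        simp only [hp.comp_natCast_mul, hJ]
    _ ≤ _ := h
    _ = _ := by push_cast; ring

/-- Under the `B₂` counting condition, sums of squares of short blocks have small variance. -/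
theorem integral_sq_sum_sq_sub_le (hp : IsTrigPoly d c p)
    (hA : ∑ j ∈ (Finset.Icc (-d : ℤ) d).erase 0, ‖c j‖ ≤ A) {q : ℝ} {K : ℤ → ℤ → ℕ} {m : ℕ → ℕ}
    (hm : LacunaryB2 q K m) {I : ℕ → Finset ℕ} {β : ℕ → ℕ} (hβ : ∀ b, ∀ i ∈ I b, β i = b)
    {L : ℕ} (hL : ∀ b, (I b).card ≤ L) (N : ℕ) :
    ∫ x in (0 : ℝ)..1, (∑ b ∈ Finset.range N, (∑ i ∈ I b, p (m i * x)) ^ 2 -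
        ∫ y in (0 : ℝ)..1, ∑ b ∈ Finset.range N, (∑ i ∈ I b, p (m i * y)) ^ 2) ^ 2 ≤
      A ^ 4 * (∑ j ∈ (Finset.Icc (-d : ℤ) d).erase 0, ∑ j' ∈ (Finset.Icc (-d : ℤ) d).erase 0,
        K j j' : ℕ) * (N * L ^ 2 * (((Finset.Icc (-d : ℤ) d).erase 0).card : ℝ) ^ 2) := by
  set J := (Finset.Icc (-d : ℤ) d).erase 0 with hJ
  set w : ℝ → ℝ := fun x => ∑ b ∈ Finset.range N, (∑ i ∈ I b, p (m i * x)) ^ 2 with hw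
  have hwc : Continuous w := by
    have := hp.continuous
    fun_prop
  set Ξ : Finset (Σ _ : ℕ, (ℕ × ℕ) × (ℤ × ℤ)) :=
    (Finset.range N).sigma fun b => (I b ×ˢ I b) ×ˢ (J ×ˢ J) with hΞ
  set a : (Σ _ : ℕ, (ℕ × ℕ) × (ℤ × ℤ)) → ℂ := fun τ => c τ.2.2.1 * c τ.2.2.2 with ha
  set ω : (Σ _ : ℕ, (ℕ × ℕ) × (ℤ × ℤ)) → ℤ :=
    fun τ => τ.2.2.1 * m τ.2.1.1 + τ.2.2.2 * m τ.2.1.2 with hω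
  have hwΞ : ∀ x, (w x : ℂ) = ∑ τ ∈ Ξ, a τ * charWave (ω τ) x := by
    intro x
    simp only [hw, hΞ, Complex.ofReal_sum, Complex.ofReal_pow, Finset.sum_sigma]
    refine Finset.sum_congr rfl fun b _ => ?_
    rw [sq, Finset.sum_mul_sum, Finset.sum_product, Finset.sum_product]
    refine Finset.sum_congr rfl fun i _ => Finset.sum_congr rfl fun i' _ => ?_
    rw [hp.comp_natCast_mul, hp.comp_natCast_mul, Finset.sum_mul_sum, Finset.sum_product]
    refine Finset.sum_congr rfl fun j _ => Finset.sum_congr rfl fun j' _ => ?_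
    simp only [ha, hω, charWave_add]
    ring
  have hmean : ((∫ y in (0 : ℝ)..1, w y : ℝ) : ℂ) = ∑ τ ∈ Ξ.filter fun τ => ω τ = 0, a τ := by
    rw [← intervalIntegral.integral_ofReal]
    simp only [hwΞ]
    rw [intervalIntegral.integral_finsetSum fun τ _ =>
      ((continuous_charWave _).intervalIntegrable _ _).const_mul _, Finset.sum_filter]
    refine Finset.sum_congr rfl fun τ _ => ?_
    rw [intervalIntegral.integral_const_mul, integral_charWave, mul_ite, mul_one, mul_zero]
  -- Subtracting the mean removes exactly the zero frequencies, for which `B₂` gives no bound.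
  set Θ := Ξ.filter fun τ => ω τ ≠ 0 with hΘ
  have hdiff : ∀ x, ((w x - ∫ y in (0 : ℝ)..1, w y : ℝ) : ℂ) =
      ∑ τ ∈ Θ, a τ * charWave (ω τ) x := by
    intro x
    rw [Complex.ofReal_sub, hmean, hwΞ, ← Finset.sum_filter_add_sum_filter_not Ξ
      (fun τ => ω τ = 0), add_sub_assoc, add_comm, sub_add, sub_eq_self, sub_eq_zero]
    refine Finset.sum_congr rfl fun τ hτ => ?_
    rw [(Finset.mem_filter.1 hτ).2, charWave_zero, mul_one]
  have hmem : ∀ τ ∈ Ξ, τ.2.1.1 ∈ I τ.1 ∧ τ.2.1.2 ∈ I τ.1 ∧ τ.2.2.1 ∈ J ∧ τ.2.2.2 ∈ J := by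
    intro τ hτ
    simp only [hΞ, Finset.mem_sigma, Finset.mem_product] at hτ
    tauto
  have hA0 : 0 ≤ A := (Finset.sum_nonneg fun _ _ => norm_nonneg _).trans hA
  -- For fixed `(j, j')`, `B₂` bounds the index pairs with a given nonzero frequency; the block is
  -- not a further freedom, being recovered from its index by `β`.
  have hcount : ∀ τ ∈ Θ, (Θ.filter fun τ' => ω τ' = ω τ).card ≤
      ∑ j ∈ J, ∑ j' ∈ J, K j j' := by
    intro τ hτ
    have hτ0 : ω τ ≠ 0 := (Finset.mem_filter.1 hτ).2
    rw [← Finset.sum_product' J J fun j j' => K j j']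
    rw [Finset.card_eq_sum_card_fiberwise (f := fun τ' => τ'.2.2) (t := J ×ˢ J)]
    · refine Finset.sum_le_sum fun jj hjj => ?_
      obtain ⟨hj, hj'⟩ := Finset.mem_product.1 hjj
      have hK := hm.count jj.1 jj.2 (Finset.mem_erase.1 hj).1 (Finset.mem_erase.1 hj').1 (ω τ) hτ0
      have : ((((Θ.filter fun τ' => ω τ' = ω τ).filter fun τ' => τ'.2.2 = jj).card : ℕ∞)) ≤
          (K jj.1 jj.2 : ℕ∞) := by
        refine le_trans ?_ hK
        rw [← Set.encard_coe_eq_coe_finsetCard]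
        refine Set.encard_le_encard_of_injOn (f := fun τ' => τ'.2.1) ?_ ?_
        · intro τ' hτ'
          simp only [Finset.coe_filter, mem_ofPred_eq, Finset.mem_filter] at hτ'
          obtain ⟨⟨_, h1⟩, h2⟩ := hτ'
          rw [← h1, ← h2]
          rfl
        · intro τ₁ h₁ τ₂ h₂ h
          simp only [Finset.coe_filter, mem_ofPred_eq, Finset.mem_filter, hΘ] at h₁ h₂
          have e1 := hβ _ _ (hmem τ₁ h₁.1.1.1).1
          have e2 := hβ _ _ (hmem τ₂ h₂.1.1.1).1
          have e3 := h₁.2.trans h₂.2.symm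
          obtain ⟨b₁, u₁, v₁⟩ := τ₁
          obtain ⟨b₂, u₂, v₂⟩ := τ₂
          simp only at h e1 e2 e3
          subst h e3
          rw [← e1, ← e2]
      exact_mod_cast this
    · intro τ' hτ'
      have := hmem τ' (Finset.mem_filter.1 (Finset.mem_filter.1 hτ').1).1
      exact Finset.mem_coe.2 (Finset.mem_product.2 ⟨this.2.2.1, this.2.2.2⟩)
  have h := integral_norm_sq_sum_charWave_le Θ a ω (A := A ^ 2) (fun τ hτ => by
    have := hmem τ (Finset.mem_filter.1 hτ).1
    rw [ha, norm_mul, sq]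
    exact mul_le_mul (norm_coeff_le hA this.2.2.1) (norm_coeff_le hA this.2.2.2)
      (norm_nonneg _) hA0) hcount
  have hcard : (Θ.card : ℝ) ≤ N * L ^ 2 * (J.card : ℝ) ^ 2 := by
    have : Θ.card ≤ N * (L ^ 2 * J.card ^ 2) := by
      refine (Finset.card_filter_le _ _).trans ?_
      rw [hΞ, Finset.card_sigma]
      refine (Finset.sum_le_card_nsmul _ _ (L ^ 2 * J.card ^ 2) fun b _ => ?_).trans ?_
      · rw [Finset.card_product, Finset.card_product, Finset.card_product, sq, sq]
        exact Nat.mul_le_mul_right _ (Nat.mul_le_mul (hL b) (hL b))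
      · simp
    calc (Θ.card : ℝ) ≤ (N * (L ^ 2 * J.card ^ 2) : ℕ) := by exact_mod_cast this
      _ = _ := by push_cast; ring
  calc _ = ∫ x in (0 : ℝ)..1, ‖∑ τ ∈ Θ, a τ * charWave (ω τ) x‖ ^ 2 := by
        refine intervalIntegral.integral_congr fun x _ => ?_
        rw [← hdiff, Complex.norm_real, Real.norm_eq_abs, sq_abs]
    _ ≤ _ := h
    _ ≤ (A ^ 2) ^ 2 * (∑ j ∈ J, ∑ j' ∈ J, K j j' : ℕ) * (N * L ^ 2 * (J.card : ℝ) ^ 2) := by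
        gcongr
    _ = _ := by ring

end IsTrigPoly

/-! ### Long blocks and their central limit theorem -/

/-- The indices below `N` lying in the block of index `b` when blocks have length `L` and the last
`s` indices of every block are left out. -/
def blockIndices (L s N b : ℕ) : Finset ℕ :=
  ((Finset.range N).filter fun i => i % L < L - s).filter fun i => i / L = b

theorem mem_blockIndices {L s N b i : ℕ} :
    i ∈ blockIndices L s N b ↔ (i < N ∧ i % L < L - s) ∧ i / L = b := by
  simp [blockIndices]

theorem card_blockIndices_le {L : ℕ} (hL : 0 < L) (s N b : ℕ) :
    (blockIndices L s N b).card ≤ L := by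
  have : blockIndices L s N b ⊆ Finset.Ico (b * L) (b * L + L) := by
    intro i hi
    rw [mem_blockIndices] at hi
    have h1 := Nat.div_add_mod i L
    have h2 := Nat.mod_lt i hL
    rw [hi.2, mul_comm] at h1
    rw [Finset.mem_Ico]
    omega
  simpa using Finset.card_le_card this

/-- Letting `b` run up to `N` is enough because `i / L ≤ i`; the superfluous blocks are empty. -/
theorem sum_blockIndices {M : Type*} [AddCommMonoid M] (L s N : ℕ) (u : ℕ → M) :
    ∑ b ∈ Finset.range N, ∑ i ∈ blockIndices L s N b, u i =
      ∑ i ∈ (Finset.range N).filter fun i => i % L < L - s, u i := by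
  refine Finset.sum_fiberwise_of_maps_to (fun i hi => ?_) u
  rw [Finset.mem_filter, Finset.mem_range] at hi
  exact Finset.mem_range.2 ((Nat.div_le_self i L).trans_lt hi.1)

/-- The `s` omitted indices give `(d + 1) * m i ≤ m (i + s)`, which leaves room for `d * m i` plus
the lower edge of the band before the next block starts. The `-1` makes the lower inequality strict.
-/
theorem blockIndices_spectrum {q : ℝ} {K : ℤ → ℤ → ℕ} {m : ℕ → ℕ} (hm : LacunaryB2 q K m)
    (hq : 1 < q) {d s L : ℕ} (hs : (d : ℝ) + 1 ≤ q ^ s) (hsL : s ≤ L) {N b i : ℕ}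
    (hi : i ∈ blockIndices L s N b) {j : ℤ} (hj : j ∈ (Finset.Icc (-d : ℤ) d).erase 0) :
    (m (L * b) : ℤ) - 1 < |j * m i| ∧
      (m (L * b) : ℤ) - 1 + |j * m i| ≤ (m (L * (b + 1)) : ℤ) - 1 := by
  rw [mem_blockIndices] at hi
  obtain ⟨⟨_, hi1⟩, rfl⟩ := hi
  have hdm := Nat.div_add_mod i L
  have hmono := hm.strictMono hq
  have h1 : m (L * (i / L)) ≤ m i := hmono.monotone (by omega)
  have h2 : m (i + s) ≤ m (L * (i / L + 1)) := hmono.monotone (by rw [mul_add]; omega)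
  have h3 := hm.pow_mul_le hq i s
  have h4 : (d + 1) * m i ≤ m (i + s) := by
    have : ((d : ℝ) + 1) * m i ≤ m (i + s) :=
      (mul_le_mul_of_nonneg_right hs (Nat.cast_nonneg _)).trans h3
    exact_mod_cast this
  rw [Finset.mem_erase, Finset.mem_Icc] at hj
  have hj1 : 1 ≤ |j| := Int.one_le_abs hj.1
  have hj2 : |j| ≤ d := abs_le.2 hj.2
  have hmi := hm.pos i
  rw [abs_mul, Nat.abs_cast]
  have h5 : (m i : ℤ) ≤ |j| * m i := le_mul_of_one_le_left (by positivity) hj1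
  have h6 : |j| * m i ≤ d * m i := mul_le_mul_of_nonneg_right hj2 (by positivity)
  have h7 : ((d : ℤ) + 1) * m i ≤ m (L * (i / L + 1)) := by exact_mod_cast h4.trans h2
  have h8 : (m (L * (i / L)) : ℤ) ≤ m i := by exact_mod_cast h1
  rw [add_mul, one_mul] at h7
  constructor <;> linarith

theorem IsTrigPoly.block_mem_trigSpan {d : ℕ} {c : ℤ → ℂ} {p : ℝ → ℝ} (hp : IsTrigPoly d c p)
    {m : ℕ → ℕ} (I : Finset ℕ) {S : Set ℤ}
    (hS : ∀ i ∈ I, ∀ j ∈ (Finset.Icc (-d : ℤ) d).erase 0, j * m i ∈ S) (z : ℂ) :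
    (fun x => ((∑ i ∈ I, p (m i * x) : ℝ) : ℂ) * z) ∈ trigSpan S := by
  have : (fun x => ((∑ i ∈ I, p (m i * x) : ℝ) : ℂ) * z) =
      z • ∑ i ∈ I, ∑ j ∈ (Finset.Icc (-d : ℤ) d).erase 0, c j • charWave (j * m i) := by
    funext x
    simp only [Complex.ofReal_sum, hp.comp_natCast_mul, Pi.smul_apply, Finset.sum_apply,
      smul_eq_mul, mul_comm z]
  rw [this]
  exact Submodule.smul_mem _ _ (Submodule.sum_mem _ fun i hi => Submodule.sum_mem _ fun j hj =>
    Submodule.smul_mem _ _ (charWave_mem_trigSpan (hS i hi j hj)))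

theorem integral_sq_sum_eq_of_orthogonal {X : ℕ → ℝ → ℝ} (hX : ∀ b, Continuous (X b))
    (horth : ∀ a b, a < b → ∫ x in (0 : ℝ)..1, X a x * X b x = 0) (N : ℕ) :
    ∫ x in (0 : ℝ)..1, (∑ b ∈ Finset.range N, X b x) ^ 2 =
      ∫ x in (0 : ℝ)..1, ∑ b ∈ Finset.range N, X b x ^ 2 := by
  have hI : ∀ a b, IntervalIntegrable (fun x => X a x * X b x) volume 0 1 := fun a b =>
    ((hX a).mul (hX b)).intervalIntegrable _ _
  simp only [sq, Finset.sum_mul_sum]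
  rw [intervalIntegral.integral_finsetSum fun a _ => by
      have := IntervalIntegrable.sum (Finset.range N) (f := fun b x => X a x * X b x)
        (fun b _ => hI _ _)
      simpa only [Finset.sum_fn] using this,
    intervalIntegral.integral_finsetSum fun a _ => hI a a]
  refine Finset.sum_congr rfl fun a ha => ?_
  rw [intervalIntegral.integral_finsetSum fun b _ => hI a b, Finset.sum_eq_single a]
  · intro b _ hb
    rcases lt_or_gt_of_ne hb with h | h
    · simp only [mul_comm (X a _)]
      exact horth b a h
    · exact horth a b h
  · exact fun h => absurd ha h

/-- Central limit theorem with a rate for the long blocks of a lacunary trigonometric sum. -/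
theorem IsTrigPoly.exists_norm_integral_exp_sub_le {d : ℕ} {c : ℤ → ℂ} {p : ℝ → ℝ}
    (hp : IsTrigPoly d c p) {q : ℝ} (hq : 1 < q) (K : ℤ → ℤ → ℕ) {s L : ℕ}
    (hs : (d : ℝ) + 1 ≤ q ^ s) (hsL : s ≤ L) (hL : 0 < L) (t : ℝ) :
    ∃ C : ℝ, ∀ N : ℕ, 0 < N → ∀ m : ℕ → ℕ, LacunaryB2 q K m →
      ‖(∫ x in (0 : ℝ)..1, Complex.exp ((t * ((√(N : ℝ))⁻¹ *
          ∑ i ∈ (Finset.range N).filter fun i => i % L < L - s, p (m i * x)) : ℝ) * Complex.I)) -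
        (Real.exp (-(t ^ 2 * (∫ x in (0 : ℝ)..1, ((√(N : ℝ))⁻¹ *
          ∑ i ∈ (Finset.range N).filter fun i => i % L < L - s, p (m i * x)) ^ 2) / 2)) : ℂ)‖ ≤
        C / √(N : ℝ) := by
  set J := (Finset.Icc (-d : ℤ) d).erase 0 with hJ
  set A : ℝ := ∑ j ∈ J, ‖c j‖ with hA
  have hA0 : 0 ≤ A := Finset.sum_nonneg fun _ _ => norm_nonneg _
  set κ : ℕ := ∑ j ∈ J, ∑ j' ∈ J, K j j' with hκ
  -- The first term comes from the cubes, the second from the fluctuation of the sum of squares.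
  -- Neither involves `m`, which gives the uniformity.
  refine ⟨4 * (|t| * (L * A)) ^ 3 +
    Real.exp ((|t| * (L * A)) ^ 2 / 2) * (t ^ 2 * √(A ^ 4 * κ * (L ^ 2 * (J.card : ℝ) ^ 2))),
    fun N hN m hm => ?_⟩
  have hN0 : (0 : ℝ) < N := by exact_mod_cast hN
  set ρ : ℝ := (√(N : ℝ))⁻¹ with hρ
  have hρ0 : 0 < ρ := inv_pos.2 (Real.sqrt_pos.2 hN0)
  have hρN : ρ ^ 2 * N = 1 := by
    rw [hρ, inv_pow, Real.sq_sqrt hN0.le, inv_mul_cancel₀ hN0.ne']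
  set U : ℕ → ℝ → ℝ := fun b x => ∑ i ∈ blockIndices L s N b, p (m i * x) with hU
  have hpc := hp.continuous
  have hUc : ∀ b, Continuous (U b) := fun b => by fun_prop
  have hUb : ∀ b x, |U b x| ≤ L * A := fun b x => by
    calc |U b x| ≤ ∑ i ∈ blockIndices L s N b, |p (m i * x)| := Finset.abs_sum_le_sum_abs _ _
      _ ≤ (blockIndices L s N b).card • A :=
          Finset.sum_le_card_nsmul _ _ _ fun i _ => hp.abs_apply_le le_rfl _
      _ ≤ L * A := by
          rw [nsmul_eq_mul]
          gcongr
          exact card_blockIndices_le hL s N b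
  set X : ℕ → ℝ → ℝ := fun b x => t * ρ * U b x with hX
  have hXc : ∀ b, Continuous (X b) := fun b => by fun_prop
  have hXb : ∀ b x, |X b x| ≤ |t| * (L * A) * ρ := fun b x => by
    rw [hX]
    simp only [abs_mul, abs_of_pos hρ0]
    calc |t| * ρ * |U b x| ≤ |t| * ρ * (L * A) := by gcongr; exact hUb b x
      _ = _ := by ring
  set D : ℕ → ℤ := fun b => (m (L * b) : ℤ) - 1 with hD
  have hD0 : 0 ≤ D 0 := by
    have := hm.pos (L * 0)
    simp only [hD]
    omega
  have hDm : Monotone D := fun a b hab => by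
    have := (hm.strictMono hq).monotone (Nat.mul_le_mul_left L hab)
    simp only [hD]
    omega
  have hspec : ∀ b, (fun x => (X b x : ℂ) * Complex.I) ∈
      trigSpan {ω | D b < |ω| ∧ D b + |ω| ≤ D (b + 1)} := by
    intro b
    have := hp.block_mem_trigSpan (m := m) (blockIndices L s N b)
      (S := {ω | D b < |ω| ∧ D b + |ω| ≤ D (b + 1)})
      (fun i hi j hj => blockIndices_spectrum hm hq hs hsL hi hj) ((t * ρ : ℝ) * Complex.I)
    convert this using 2 with x
    simp only [hX, hU]
    push_cast
    ring
  have hprod : ∫ x in (0 : ℝ)..1, ∏ b ∈ Finset.range N, (1 + X b x * Complex.I : ℂ) = 1 :=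
    integral_prod_one_add_eq_one hD0 hDm hspec N
  have horth : ∀ a b, a < b → ∫ x in (0 : ℝ)..1, X a x * X b x = 0 := by
    intro a b hab
    have h := integral_mul_eq_zero_of_lt hD0 hDm hspec hab
    have e : ∀ x, (X a x : ℂ) * Complex.I * ((X b x : ℂ) * Complex.I) =
        -((X a x * X b x : ℝ) : ℂ) := fun x => by
      rw [mul_mul_mul_comm, Complex.I_mul_I]
      push_cast
      ring
    simp only [e] at h
    rw [intervalIntegral.integral_neg, neg_eq_zero, intervalIntegral.integral_ofReal] at h
    exact_mod_cast h
  have hsumX : ∀ x, ∑ b ∈ Finset.range N, X b x = t * (ρ *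
      ∑ i ∈ (Finset.range N).filter fun i => i % L < L - s, p (m i * x)) := fun x => by
    rw [← sum_blockIndices L s N fun i => p (m i * x), ← mul_assoc, Finset.mul_sum]
  set v : ℝ := ∫ x in (0 : ℝ)..1, ∑ b ∈ Finset.range N, X b x ^ 2 with hv
  have hv0 : 0 ≤ v := intervalIntegral.integral_nonneg zero_le_one fun x _ =>
    Finset.sum_nonneg fun b _ => sq_nonneg _
  -- Distinct blocks are orthogonal, so the second moment of the sum is the mean of the sum of
  -- squares.
  have hvY : t ^ 2 * (∫ x in (0 : ℝ)..1, (ρ *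
      ∑ i ∈ (Finset.range N).filter fun i => i % L < L - s, p (m i * x)) ^ 2) = v := by
    rw [hv, ← integral_sq_sum_eq_of_orthogonal hXc horth N,
      ← intervalIntegral.integral_const_mul]
    simp only [hsumX, mul_pow]
  rw [hvY]
  simp only [← hsumX]
  have hX2 : ∀ x, ∑ b ∈ Finset.range N, X b x ^ 2 ≤ (|t| * (L * A)) ^ 2 := fun x => by
    calc ∑ b ∈ Finset.range N, X b x ^ 2 ≤ (Finset.range N).card • (|t| * (L * A) * ρ) ^ 2 :=
          Finset.sum_le_card_nsmul _ _ _ fun b _ => by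
            rw [← sq_abs]
            exact pow_le_pow_left₀ (abs_nonneg _) (hXb b x) 2
      _ = (|t| * (L * A)) ^ 2 * (ρ ^ 2 * N) := by
          rw [Finset.card_range, nsmul_eq_mul]; ring
      _ = _ := by rw [hρN, mul_one]
  have hX3 : ∀ x, ∑ b ∈ Finset.range N, |X b x| ^ 3 ≤ (|t| * (L * A)) ^ 3 * ρ := fun x => by
    calc ∑ b ∈ Finset.range N, |X b x| ^ 3 ≤ (Finset.range N).card • (|t| * (L * A) * ρ) ^ 3 :=
          Finset.sum_le_card_nsmul _ _ _ fun b _ =>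
            pow_le_pow_left₀ (abs_nonneg _) (hXb b x) 3
      _ = (|t| * (L * A)) ^ 3 * ρ * (ρ ^ 2 * N) := by
          rw [Finset.card_range, nsmul_eq_mul]; ring
      _ = _ := by rw [hρN, mul_one]
  refine (norm_integral_exp_sub_le (Finset.range N) hXc hv0 hX2 hX3 hprod).trans ?_
  -- The variance is at most a constant times `ρ ^ 4 * N = ρ ^ 2`; Cauchy–Schwarz turns this into a
  -- first-moment bound of order `ρ`.
  have hvar : ∫ x in (0 : ℝ)..1, |∑ b ∈ Finset.range N, X b x ^ 2 - v| ≤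
      t ^ 2 * √(A ^ 4 * κ * (L ^ 2 * (J.card : ℝ) ^ 2)) * ρ := by
    have hc : Continuous fun x => ∑ b ∈ Finset.range N, X b x ^ 2 - v := by fun_prop
    have h1 := sq_integral_abs_le (hc.intervalIntegrable 0 1) ((hc.pow 2).intervalIntegrable 0 1)
    have h2 := hp.integral_sq_sum_sq_sub_le le_rfl hm (I := blockIndices L s N)
      (β := fun i => i / L) (fun b i hi => (mem_blockIndices.1 hi).2)
      (fun b => card_blockIndices_le hL s N b) N
    have hXU : ∀ x, ∑ b ∈ Finset.range N, X b x ^ 2 =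
        (t * ρ) ^ 2 * ∑ b ∈ Finset.range N, (∑ i ∈ blockIndices L s N b, p (m i * x)) ^ 2 :=
      fun x => by
        rw [Finset.mul_sum]
        simp only [hX, hU, mul_pow]
    have h3 : ∫ x in (0 : ℝ)..1, (∑ b ∈ Finset.range N, X b x ^ 2 - v) ^ 2 ≤
        (t * ρ) ^ 4 * (A ^ 4 * κ * (N * L ^ 2 * (J.card : ℝ) ^ 2)) := by
      rw [hv]
      simp only [hXU]
      rw [intervalIntegral.integral_const_mul]
      simp only [← mul_sub]
      simp only [mul_pow _ _ 2]
      rw [intervalIntegral.integral_const_mul]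
      calc _ = (t * ρ) ^ 4 * _ := by congr 1; ring
        _ ≤ _ := mul_le_mul_of_nonneg_left h2 (by positivity)
    refine le_of_sq_le_sq (h1.trans (h3.trans (le_of_eq ?_))) (by positivity)
    rw [mul_pow _ ρ 2, mul_pow (t ^ 2) _ 2, Real.sq_sqrt (by positivity)]
    calc _ = (t ^ 2) ^ 2 * (A ^ 4 * κ * (L ^ 2 * (J.card : ℝ) ^ 2)) * ρ ^ 2 * (ρ ^ 2 * N) := by
          ring
      _ = _ := by rw [hρN, mul_one]
  calc _ ≤ 4 * ((|t| * (L * A)) ^ 3 * ρ) + Real.exp ((|t| * (L * A)) ^ 2 / 2) *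
        (t ^ 2 * √(A ^ 4 * κ * (L ^ 2 * (J.card : ℝ) ^ 2)) * ρ) := by gcongr
    _ = _ := by rw [div_eq_mul_inv _ (√(N : ℝ)), ← hρ]; ring

/-! ### Bounded measurable functions -/

/-- Bounded measurable real functions. -/
def BoundedMeasurable (u : ℝ → ℝ) : Prop := Measurable u ∧ ∃ M, ∀ x, |u x| ≤ M

namespace BoundedMeasurable

variable {u v : ℝ → ℝ}

theorem intervalIntegrable (hu : BoundedMeasurable u) (a b : ℝ) :
    IntervalIntegrable u volume a b := by
  obtain ⟨h, M, hM⟩ := hu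
  exact intervalIntegrable_of_bound h.aestronglyMeasurable M hM a b

theorem add (hu : BoundedMeasurable u) (hv : BoundedMeasurable v) :
    BoundedMeasurable fun x => u x + v x := by
  obtain ⟨h, M, hM⟩ := hu
  obtain ⟨h', M', hM'⟩ := hv
  exact ⟨h.add h', M + M', fun x => (abs_add_le _ _).trans (add_le_add (hM x) (hM' x))⟩

theorem mul (hu : BoundedMeasurable u) (hv : BoundedMeasurable v) :
    BoundedMeasurable fun x => u x * v x := by
  obtain ⟨h, M, hM⟩ := hu
  obtain ⟨h', M', hM'⟩ := hv
  refine ⟨h.mul h', M * M', fun x => ?_⟩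
  rw [abs_mul]
  exact mul_le_mul (hM x) (hM' x) (abs_nonneg _) ((abs_nonneg _).trans (hM x))

theorem const (z : ℝ) : BoundedMeasurable fun _ => z := ⟨measurable_const, |z|, fun _ => le_rfl⟩

theorem const_mul (hu : BoundedMeasurable u) (z : ℝ) : BoundedMeasurable fun x => z * u x :=
  (const z).mul hu

theorem sub (hu : BoundedMeasurable u) (hv : BoundedMeasurable v) :
    BoundedMeasurable fun x => u x - v x := by
  simpa [sub_eq_add_neg] using hu.add (hv.const_mul (-1))

theorem sq (hu : BoundedMeasurable u) : BoundedMeasurable fun x => u x ^ 2 := by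
  simpa only [pow_two] using hu.mul hu

theorem abs (hu : BoundedMeasurable u) : BoundedMeasurable fun x => |u x| := by
  obtain ⟨h, M, hM⟩ := hu
  exact ⟨by simpa only [Real.norm_eq_abs] using h.norm, M, fun x => by rw [abs_abs]; exact hM x⟩

theorem comp_mul (hu : BoundedMeasurable u) (z : ℝ) : BoundedMeasurable fun x => u (z * x) := by
  obtain ⟨h, M, hM⟩ := hu
  exact ⟨h.comp (measurable_const_mul z), M, fun x => hM _⟩

theorem sum {ι : Type*} (s : Finset ι) {w : ι → ℝ → ℝ} (hw : ∀ i, BoundedMeasurable (w i)) :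
    BoundedMeasurable fun x => ∑ i ∈ s, w i x := by
  classical
  induction s using Finset.induction_on with
  | empty => simpa using const 0
  | insert i s hi ih => simpa only [Finset.sum_insert hi] using (hw i).add ih

end BoundedMeasurable

/-! ### The high-frequency residual -/

theorem IsTrigPoly.boundedMeasurable {d : ℕ} {c : ℤ → ℂ} {p : ℝ → ℝ} (hp : IsTrigPoly d c p) :
    BoundedMeasurable p :=
  ⟨hp.continuous.measurable, _, hp.abs_apply_le le_rfl⟩

theorem IsTrigPoly.periodic {d : ℕ} {c : ℤ → ℂ} {p : ℝ → ℝ} (hp : IsTrigPoly d c p) :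
    Function.Periodic p 1 := fun x => by
  have : (p (x + 1) : ℂ) = p x := by
    rw [hp, hp]
    simp only [periodic_charWave _ x]
  exact_mod_cast this

/-- The frequencies of `p (k x)` are at most `d k ≤ d l` in modulus, and `r (l x)` has none in that
range. -/
theorem IsTrigPoly.integral_comp_mul_residual_eq_zero {d : ℕ} {c : ℤ → ℂ} {p r : ℝ → ℝ}
    (hp : IsTrigPoly d c p) (hr : BoundedMeasurable r) (hper : Function.Periodic r 1)
    (horth : ∀ j : ℤ, |j| ≤ d → ∫ x in (0 : ℝ)..1, charWave j x * (r x : ℂ) = 0)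
    {k l : ℕ} (hk : 0 < k) (hkl : k ≤ l) :
    ∫ x in (0 : ℝ)..1, p (k * x) * r (l * x) = 0 := by
  obtain ⟨hrm, M, hrb⟩ := id hr
  rw [← Complex.ofReal_inj, ← intervalIntegral.integral_ofReal]
  simp only [Complex.ofReal_mul, hp.comp_natCast_mul, Finset.sum_mul, Complex.ofReal_zero,
    mul_assoc]
  rw [intervalIntegral.integral_finsetSum fun j _ =>
    (intervalIntegrable_charWave_mul (f := fun x => r (l * x)) (hrm.comp (measurable_const_mul (l : ℝ)))
      (fun x => hrb _) _ 0 1).const_mul _]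
  refine Finset.sum_eq_zero fun j hj => ?_
  rw [Finset.mem_erase, Finset.mem_Icc] at hj
  rw [intervalIntegral.integral_const_mul,
    integral_charWave_mul_comp_eq_zero hrm hrb hper horth (hk.trans_le hkl), mul_zero]
  rw [abs_mul, Nat.abs_cast]
  exact mul_le_mul (abs_le.2 hj.2) (by exact_mod_cast hkl) (by positivity) (by positivity)

theorem sum_pow_sub_le {ρ : ℝ} (h0 : 0 ≤ ρ) (h1 : ρ < 1) (N : ℕ) :
    ∑ i ∈ Finset.range N, ρ ^ (N - i) ≤ ρ / (1 - ρ) := by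
  have h2 : 0 < 1 - ρ := by linarith
  induction N with
  | zero => simpa using div_nonneg h0 h2.le
  | succ N ih =>
    have : ∑ i ∈ Finset.range N, ρ ^ (N + 1 - i) = ρ * ∑ i ∈ Finset.range N, ρ ^ (N - i) := by
      rw [Finset.mul_sum]
      refine Finset.sum_congr rfl fun i hi => ?_
      rw [Finset.mem_range] at hi
      rw [Nat.succ_sub hi.le, pow_succ']
    rw [Finset.sum_range_succ, this, Nat.add_sub_cancel_left, pow_one]
    calc ρ * ∑ i ∈ Finset.range N, ρ ^ (N - i) + ρ ≤ ρ * (ρ / (1 - ρ)) + ρ := by gcongr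
      _ = ρ / (1 - ρ) := by field_simp; ring

/-- Appending one term costs its square and twice its correlations with the earlier ones, a
geometric sum independent of `N`. -/
theorem integral_sq_sum_le_of_correlation {u : ℕ → ℝ → ℝ} (hu : ∀ i, BoundedMeasurable (u i))
    {ρ B : ℝ} (h0 : 0 ≤ ρ) (h1 : ρ < 1) (hB : 0 ≤ B)
    (hdiag : ∀ i, ∫ x in (0 : ℝ)..1, u i x ^ 2 ≤ B)
    (hcorr : ∀ i k, i < k → ∫ x in (0 : ℝ)..1, u i x * u k x ≤ B * ρ ^ (k - i)) (N : ℕ) :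
    ∫ x in (0 : ℝ)..1, (∑ i ∈ Finset.range N, u i x) ^ 2 ≤
      B * (1 + 2 * (ρ / (1 - ρ))) * N := by
  induction N with
  | zero => simp
  | succ N ih =>
    have e : ∀ x, (∑ i ∈ Finset.range (N + 1), u i x) ^ 2 =
        (∑ i ∈ Finset.range N, u i x) ^ 2 +
          (2 * ∑ i ∈ Finset.range N, u i x * u N x + u N x ^ 2) := fun x => by
      rw [Finset.sum_range_succ, ← Finset.sum_mul]; ring
    have hS := BoundedMeasurable.sum (Finset.range N) hu
    have hm : ∀ i, BoundedMeasurable fun x => u i x * u N x := fun i => (hu i).mul (hu N)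
    have hc := (BoundedMeasurable.sum (Finset.range N) hm).const_mul 2
    simp only [e]
    rw [intervalIntegral.integral_add (hS.sq.intervalIntegrable _ _)
      ((hc.add (hu N).sq).intervalIntegrable _ _),
      intervalIntegral.integral_add (hc.intervalIntegrable _ _)
      ((hu N).sq.intervalIntegrable _ _), intervalIntegral.integral_const_mul,
      intervalIntegral.integral_finsetSum fun i _ => (hm i).intervalIntegrable _ _]
    have h3 : ∑ i ∈ Finset.range N, ∫ x in (0 : ℝ)..1, u i x * u N x ≤ B * (ρ / (1 - ρ)) :=
      calc _ ≤ ∑ i ∈ Finset.range N, B * ρ ^ (N - i) :=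
            Finset.sum_le_sum fun i hi => hcorr i N (Finset.mem_range.1 hi)
        _ ≤ _ := by
            rw [← Finset.mul_sum]
            exact mul_le_mul_of_nonneg_left (sum_pow_sub_le h0 h1 N) hB
    have := hdiag N
    push_cast
    linarith

/-- Mean square of lacunary sums of the high-frequency part of a function of bounded variation. -/
theorem integral_sq_sum_residual_le {f p T : ℝ → ℝ} {V : ℝ} (hf : BoundedMeasurable f)
    (hfper : Function.Periodic f 1) (hV : 0 ≤ V)
    (hT : ∀ x y, 0 ≤ x → x ≤ y → |f y - f x| ≤ T y - T x)
    (hTm : ∀ m : ℕ, T m - T 0 ≤ m * V) {d : ℕ} {c : ℤ → ℂ} (hp : IsTrigPoly d c p)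
    (horth : ∀ j : ℤ, |j| ≤ d → ∫ x in (0 : ℝ)..1, charWave j x * ((f x - p x : ℝ) : ℂ) = 0)
    {B : ℝ} (hB2 : ∫ x in (0 : ℝ)..1, (f x - p x) ^ 2 ≤ B)
    (hB1 : V * ∫ x in (0 : ℝ)..1, |f x - p x| ≤ B)
    {q : ℝ} (hq : 1 < q) {K : ℤ → ℤ → ℕ} {m : ℕ → ℕ} (hm : LacunaryB2 q K m) (N : ℕ) :
    ∫ x in (0 : ℝ)..1, (∑ i ∈ Finset.range N, (f (m i * x) - p (m i * x))) ^ 2 ≤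
      B * (1 + 2 * (q⁻¹ / (1 - q⁻¹))) * N := by
  set r : ℝ → ℝ := fun x => f x - p x with hr
  have hrbm : BoundedMeasurable r := hf.sub hp.boundedMeasurable
  have hrper : Function.Periodic r 1 := fun x => by simp only [hr, hfper x, hp.periodic x]
  have hmean : ∫ x in (0 : ℝ)..1, r x = 0 := by
    have h := horth 0 (by simp)
    simp only [charWave_zero, one_mul] at h
    rw [intervalIntegral.integral_ofReal] at h
    exact_mod_cast h
  have hB : 0 ≤ B :=
    (intervalIntegral.integral_nonneg zero_le_one fun x _ => sq_nonneg _).trans hB2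
  have hq0 : 0 < q := by linarith
  refine integral_sq_sum_le_of_correlation (u := fun i x => r (m i * x))
    (fun i => hrbm.comp_mul _) (inv_nonneg.2 hq0.le) (inv_lt_one_of_one_lt₀ hq) hB
    (fun i => ?_) (fun k l hkl => ?_) N
  · have hsqper : Function.Periodic (fun x => r x ^ 2) 1 := fun x => by simp only [hrper x]
    have := hsqper.integral_comp_nat_mul (fun a b => hrbm.sq.intervalIntegrable a b) (hm.pos i)
    exact this.trans_le hB2
  · have hml : m k < m l := hm.strictMono hq hkl
    have h0 := hp.integral_comp_mul_residual_eq_zero hrbm hrper horth (hm.pos k) hml.le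
    -- Only the slower factor is split. Its `p` part drops out, so the estimate involves the
    -- variation of `f`, which does not grow with `d`, times the small norm of `r`.
    have e : ∀ x, r (m k * x) * r (m l * x) =
        f (m k * x) * r (m l * x) - p (m k * x) * r (m l * x) := fun x => by
      simp only [hr]; ring
    simp only [e]
    rw [intervalIntegral.integral_sub
      (((hf.comp_mul _).mul (hrbm.comp_mul _)).intervalIntegrable _ _)
      (((hp.boundedMeasurable.comp_mul _).mul (hrbm.comp_mul _)).intervalIntegrable _ _), h0,
      sub_zero]
    obtain ⟨hfm, Mf, hMf⟩ := hf
    obtain ⟨hrm, Mr, hMr⟩ := hrbm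
    refine (le_abs_self _).trans ((abs_integral_mul_comp_le hfm hMf hT hTm hrm hrper hMr hmean
      (hm.pos l)).trans ?_)
    have hml0 : (0 : ℝ) < m l := by exact_mod_cast hm.pos l
    have hratio : (m k / m l : ℝ) ≤ q⁻¹ ^ (l - k) := by
      have := hm.pow_mul_le hq k (l - k)
      rw [Nat.add_sub_cancel' hkl.le] at this
      rw [inv_pow, div_le_iff₀ hml0, inv_mul_eq_div, le_div_iff₀ (by positivity), mul_comm]
      exact this
    rw [mul_assoc, mul_comm B]
    have hnn : 0 ≤ V * ∫ x in (0 : ℝ)..1, |r x| :=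
      mul_nonneg hV (intervalIntegral.integral_nonneg zero_le_one fun x _ => abs_nonneg _)
    exact mul_le_mul hratio hB1 hnn (by positivity)

/-! ### Reduction to block sums of trigonometric polynomials -/

theorem card_filter_not_mod_lt_le {L s : ℕ} (hL : 0 < L) (hsL : s ≤ L) (N : ℕ) :
    ((Finset.range N).filter fun i => ¬ i % L < L - s).card ≤ (N / L + 1) * s := by
  have : ((Finset.range N).filter fun i => ¬ i % L < L - s).card ≤
      (Finset.range (N / L + 1) ×ˢ Finset.Ico (L - s) L).card := by
    refine Finset.card_le_card_of_injOn (fun i => (i / L, i % L)) (fun i hi => ?_)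
      fun i _ k _ hik => ?_
    · have hi' := Finset.mem_filter.1 hi
      rw [Finset.mem_range] at hi'
      have h1 := Nat.div_le_div_right (c := L) hi'.1.le
      have h2 := Nat.mod_lt i hL
      simp only [Finset.coe_product, Set.mem_prod, Finset.coe_range, Set.mem_Iio, Finset.coe_Ico,
        Set.mem_Ico]
      omega
    · simp only [Prod.mk.injEq] at hik
      rw [← Nat.div_add_mod i L, ← Nat.div_add_mod k L, hik.1, hik.2]
  refine this.trans ?_
  rw [Finset.card_product, Finset.card_range, Nat.card_Ico]
  exact Nat.mul_le_mul_left _ (by omega)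

/-- A function of bounded variation can be replaced, in lacunary sums, by a trigonometric
polynomial summed over long blocks of indices, up to a small mean square error. -/
theorem exists_block_approximation {f : ℝ → ℝ} (hf : BoundedMeasurable f)
    (hfper : Function.Periodic f 1) (hmean : ∫ x in (0 : ℝ)..1, f x = 0)
    (hvar : BoundedVariationOn f (Icc (0 : ℝ) 1)) {q : ℝ} (hq : 1 < q) (K : ℤ → ℤ → ℕ)
    {θ : ℝ} (hθ : 0 < θ) :
    ∃ (d : ℕ) (c : ℤ → ℂ) (p : ℝ → ℝ) (s L : ℕ), IsTrigPoly d c p ∧ (d : ℝ) + 1 ≤ q ^ s ∧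
      s ≤ L ∧ 0 < L ∧ ∀ N : ℕ, L ≤ N → ∀ m : ℕ → ℕ, LacunaryB2 q K m →
        ∫ x in (0 : ℝ)..1, ((√(N : ℝ))⁻¹ * ∑ i ∈ Finset.range N, f (m i * x) -
          (√(N : ℝ))⁻¹ * ∑ i ∈ (Finset.range N).filter fun i => i % L < L - s,
            p (m i * x)) ^ 2 ≤ θ := by
  obtain ⟨V, T, hV, hT, hTm⟩ := exists_dominating_variation hfper hvar
  obtain ⟨hfm, M, hM⟩ := id hf
  have hqi : 0 < 1 - q⁻¹ := sub_pos.2 (inv_lt_one_of_one_lt₀ hq)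
  have hq0 : 0 < q := by linarith
  set C : ℝ := 1 + 2 * (q⁻¹ / (1 - q⁻¹)) with hC
  have hC0 : 0 < C := by positivity
  set B : ℝ := θ / (4 * C) with hB
  have hB0 : 0 < B := by positivity
  -- The first entry controls `∫ r²`; the second controls `V * ∫ |r|` by Cauchy–Schwarz, with `V +
  -- 1` avoiding a division by zero.
  have hδ : 0 < min B ((B / (V + 1)) ^ 2) := lt_min hB0 (by positivity)
  obtain ⟨d, c, p, hc0, hp, horth, hL2⟩ := exists_trigonometric_approximation hfm hM hmean hδ
  have hp' : IsTrigPoly d c p := fun x => by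
    rw [hp x, ← Finset.add_sum_erase (Finset.Icc (-d : ℤ) d) _ (a := 0) (by simp), hc0,
      zero_mul, zero_add]
  have hpb := hp'.boundedMeasurable
  have hB2 : ∫ x in (0 : ℝ)..1, (f x - p x) ^ 2 ≤ B := hL2.le.trans (min_le_left _ _)
  have hB1 : V * ∫ x in (0 : ℝ)..1, |f x - p x| ≤ B := by
    have h1 := sq_integral_abs_le ((hf.sub hpb).intervalIntegrable 0 1)
      ((hf.sub hpb).sq.intervalIntegrable 0 1)
    have h2 : ∫ x in (0 : ℝ)..1, |f x - p x| ≤ B / (V + 1) :=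
      le_of_sq_le_sq (h1.trans (hL2.le.trans (min_le_right _ _))) (by positivity)
    calc _ ≤ V * (B / (V + 1)) := mul_le_mul_of_nonneg_left h2 hV
      _ = B * (V / (V + 1)) := by ring
      _ ≤ B * 1 := by gcongr; rw [div_le_one (by positivity)]; linarith
      _ = B := mul_one B
  obtain ⟨s, hs⟩ := pow_unbounded_of_one_lt ((d : ℝ) + 1) hq
  set J := (Finset.Icc (-d : ℤ) d).erase 0 with hJ
  set E : ℝ := (∑ j ∈ J, ‖c j‖) ^ 2 * (J.card : ℝ) ^ 2 with hE
  have hE0 : 0 ≤ E := by positivity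
  -- For `N ≥ L` at most `2 N s / L` indices are omitted, contributing at most `2 E N s / L` to the
  -- mean square; this choice makes it at most `θ N / 4`.
  obtain ⟨L₀, hL₀⟩ := exists_nat_ge (8 * E * s / θ)
  set L := max L₀ (s + 1) with hL
  have hLs : s + 1 ≤ L := le_max_right _ _
  have hL0 : 0 < L := by omega
  have hLR : (0 : ℝ) < L := by exact_mod_cast hL0
  have hLE : 8 * E * s ≤ θ * L := by
    have : (L₀ : ℝ) ≤ L := by exact_mod_cast le_max_left _ _
    rw [← div_le_iff₀' hθ]
    exact hL₀.trans this
  refine ⟨d, c, p, s, L, hp', hs.le, by omega, hL0, fun N hN m hm => ?_⟩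
  have hNR : (0 : ℝ) < N := by exact_mod_cast hL0.trans_le hN
  set ρ : ℝ := (√(N : ℝ))⁻¹ with hρ
  have hρN : ρ ^ 2 * N = 1 := by
    rw [hρ, inv_pow, Real.sq_sqrt hNR.le, inv_mul_cancel₀ hNR.ne']
  set R : ℝ → ℝ := fun x => ∑ i ∈ Finset.range N, (f (m i * x) - p (m i * x)) with hR
  set Z : ℝ → ℝ := fun x => ∑ i ∈ (Finset.range N).filter fun i => ¬ i % L < L - s, p (m i * x)
    with hZ
  have hRb : BoundedMeasurable R :=
    BoundedMeasurable.sum _ fun i => (hf.comp_mul _).sub (hpb.comp_mul _)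
  have hZb : BoundedMeasurable Z := BoundedMeasurable.sum _ fun i => hpb.comp_mul _
  have hRint : ∫ x in (0 : ℝ)..1, R x ^ 2 ≤ B * C * N :=
    integral_sq_sum_residual_le hf hfper hV hT hTm hp' horth hB2 hB1 hq hm N
  have hZint : ∫ x in (0 : ℝ)..1, Z x ^ 2 ≤ θ / 4 * N := by
    refine (hp'.integral_sq_sum_le le_rfl (hm.strictMono hq).injective _).trans ?_
    have hcard : (((Finset.range N).filter fun i => ¬ i % L < L - s).card : ℝ) ≤
        2 * N / L * s := by
      have h1 : (((Finset.range N).filter fun i => ¬ i % L < L - s).card : ℝ) ≤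
          ((N / L : ℕ) + 1) * s := by
        exact_mod_cast card_filter_not_mod_lt_le hL0 (by omega) N
      have h2 : ((N / L : ℕ) : ℝ) ≤ N / L := Nat.cast_div_le
      have h3 : (1 : ℝ) ≤ N / L := by
        rw [one_le_div hLR]; exact_mod_cast hN
      calc _ ≤ _ := h1
        _ ≤ (N / L + N / L : ℝ) * s := by gcongr
        _ = _ := by ring
    calc _ ≤ E * (2 * N / L * s) := mul_le_mul_of_nonneg_left hcard hE0
      _ = (8 * E * s) / L * (N / 4) := by ring
      _ ≤ θ * (N / 4) := by
          gcongr
          rw [div_le_iff₀ hLR]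
          exact hLE
      _ = _ := by ring
  have e : ∀ x, (ρ * ∑ i ∈ Finset.range N, f (m i * x) -
      ρ * ∑ i ∈ (Finset.range N).filter fun i => i % L < L - s, p (m i * x)) =
      ρ * (R x + Z x) := fun x => by
    simp only [hR, hZ, Finset.sum_sub_distrib]
    rw [← Finset.sum_filter_add_sum_filter_not (Finset.range N) (fun i => i % L < L - s)
      (fun i => p (m i * x))]
    ring
  simp only [e]
  calc _ ≤ ∫ x in (0 : ℝ)..1, ρ ^ 2 * (2 * R x ^ 2 + 2 * Z x ^ 2) := by
        refine intervalIntegral.integral_mono_on zero_le_one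
          (((hRb.add hZb).const_mul ρ).sq.intervalIntegrable _ _)
          ((((hRb.sq.const_mul 2).add (hZb.sq.const_mul 2)).const_mul _).intervalIntegrable _ _)
          fun x _ => ?_
        rw [mul_pow]
        exact mul_le_mul_of_nonneg_left (by nlinarith [sq_nonneg (R x - Z x)]) (sq_nonneg ρ)
    _ = ρ ^ 2 * (2 * (∫ x in (0 : ℝ)..1, R x ^ 2) + 2 * ∫ x in (0 : ℝ)..1, Z x ^ 2) := by
        rw [intervalIntegral.integral_const_mul, intervalIntegral.integral_add
          ((hRb.sq.const_mul 2).intervalIntegrable _ _)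
          ((hZb.sq.const_mul 2).intervalIntegrable _ _), intervalIntegral.integral_const_mul,
          intervalIntegral.integral_const_mul]
    _ ≤ ρ ^ 2 * (2 * (B * C * N) + 2 * (θ / 4 * N)) := by gcongr
    _ = (ρ ^ 2 * N) * (2 * (B * C) + θ / 2) := by ring
    _ = θ := by
        rw [hρN, hB]
        field_simp
        ring

theorem exists_integral_sq_lacunary_sum_le {f : ℝ → ℝ} (hf : BoundedMeasurable f)
    (hfper : Function.Periodic f 1) (hmean : ∫ x in (0 : ℝ)..1, f x = 0)
    (hvar : BoundedVariationOn f (Icc (0 : ℝ) 1)) {q : ℝ} (hq : 1 < q) (K : ℤ → ℤ → ℕ) :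
    ∃ C : ℝ, 0 ≤ C ∧ ∀ (N : ℕ) (m : ℕ → ℕ), LacunaryB2 q K m →
      ∫ x in (0 : ℝ)..1, ((√(N : ℝ))⁻¹ * ∑ i ∈ Finset.range N, f (m i * x)) ^ 2 ≤ C := by
  obtain ⟨V, T, hV, hT, hTm⟩ := exists_dominating_variation hfper hvar
  -- The residual estimate is applied with `p = 0`, so that `f` is its own residual.
  have h0 : IsTrigPoly 0 0 0 := fun x => by simp
  set B : ℝ := (∫ x in (0 : ℝ)..1, f x ^ 2) + V * ∫ x in (0 : ℝ)..1, |f x| with hB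
  have hB1 : 0 ≤ ∫ x in (0 : ℝ)..1, f x ^ 2 :=
    intervalIntegral.integral_nonneg zero_le_one fun x _ => sq_nonneg _
  have hB2 : 0 ≤ V * ∫ x in (0 : ℝ)..1, |f x| :=
    mul_nonneg hV (intervalIntegral.integral_nonneg zero_le_one fun x _ => abs_nonneg _)
  have hqi : 0 < 1 - q⁻¹ := sub_pos.2 (inv_lt_one_of_one_lt₀ hq)
  have hq0 : 0 < q := by linarith
  have hC0 : 0 ≤ B * (1 + 2 * (q⁻¹ / (1 - q⁻¹))) := by positivity
  refine ⟨B * (1 + 2 * (q⁻¹ / (1 - q⁻¹))), hC0, fun N m hm => ?_⟩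
  have h := integral_sq_sum_residual_le hf hfper hV hT hTm h0 (B := B) (fun j hj => by
    have : j = 0 := by simpa using hj
    subst this
    simp [charWave_zero, intervalIntegral.integral_ofReal, hmean])
    (by simp only [Pi.zero_apply, sub_zero]; linarith)
    (by simp only [Pi.zero_apply, sub_zero]; linarith) hq hm N
  simp only [Pi.zero_apply, sub_zero] at h
  simp only [mul_pow]
  rw [intervalIntegral.integral_const_mul, inv_pow, Real.sq_sqrt (Nat.cast_nonneg N)]
  rcases Nat.eq_zero_or_pos N with rfl | hN
  · simpa using hC0
  · rw [inv_mul_le_iff₀ (by exact_mod_cast hN), mul_comm (N : ℝ)]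
    exact h

/-! ### Uniform normal approximation for lacunary sums -/

theorem norm_exp_mul_I_sub_exp_mul_I_le (a b : ℝ) :
    ‖Complex.exp (a * Complex.I) - Complex.exp (b * Complex.I)‖ ≤ |a - b| := by
  have e : Complex.exp (a * Complex.I) - Complex.exp (b * Complex.I) =
      Complex.exp (b * Complex.I) * (Complex.exp (Complex.I * ((a - b : ℝ) : ℂ)) - 1) := by
    rw [mul_sub, ← Complex.exp_add, mul_one]
    congr 2
    push_cast
    ring
  rw [e, norm_mul, Complex.norm_exp_ofReal_mul_I, one_mul, ← Real.norm_eq_abs]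
  exact Real.norm_exp_I_mul_ofReal_sub_one_le

theorem BoundedMeasurable.intervalIntegrable_exp {u : ℝ → ℝ} (hu : BoundedMeasurable u) (t : ℝ) :
    IntervalIntegrable (fun x => Complex.exp ((t * u x : ℝ) * Complex.I)) volume 0 1 := by
  refine intervalIntegrable_of_bound (Measurable.aestronglyMeasurable ?_) 1
    (fun x => (Complex.norm_exp_ofReal_mul_I _).le) 0 1
  have := hu.1
  fun_prop

/-- Stability of the comparison with a centred Gaussian characteristic function under mean square
perturbations. -/
theorem norm_integral_exp_sub_gaussian_le {S Y : ℝ → ℝ} (hS : BoundedMeasurable S)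
    (hY : BoundedMeasurable Y) {C θ : ℝ} (hθ : 0 < θ)
    (hC : ∫ x in (0 : ℝ)..1, S x ^ 2 ≤ C)
    (hSY : ∫ x in (0 : ℝ)..1, (S x - Y x) ^ 2 ≤ θ ^ 2) (t : ℝ) :
    ‖(∫ x in (0 : ℝ)..1, Complex.exp ((t * S x : ℝ) * Complex.I)) -
        (Real.exp (-(t ^ 2 * (∫ x in (0 : ℝ)..1, S x ^ 2) / 2)) : ℂ)‖ ≤
      |t| * θ + t ^ 2 * (θ * (C + 1) + θ ^ 2) +
      ‖(∫ x in (0 : ℝ)..1, Complex.exp ((t * Y x : ℝ) * Complex.I)) -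
        (Real.exp (-(t ^ 2 * (∫ x in (0 : ℝ)..1, Y x ^ 2) / 2)) : ℂ)‖ := by
  have hU := hS.sub hY
  have hU1 : ∫ x in (0 : ℝ)..1, |S x - Y x| ≤ θ :=
    le_of_sq_le_sq ((sq_integral_abs_le (hU.intervalIntegrable 0 1)
      (hU.sq.intervalIntegrable 0 1)).trans hSY) hθ.le
  have h1 : ‖(∫ x in (0 : ℝ)..1, Complex.exp ((t * S x : ℝ) * Complex.I)) -
      ∫ x in (0 : ℝ)..1, Complex.exp ((t * Y x : ℝ) * Complex.I)‖ ≤ |t| * θ := by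
    rw [← intervalIntegral.integral_sub (hS.intervalIntegrable_exp t)
      (hY.intervalIntegrable_exp t)]
    calc _ ≤ ∫ x in (0 : ℝ)..1, |t| * |S x - Y x| := by
          refine intervalIntegral.norm_integral_le_of_norm_le zero_le_one
            (ae_of_all _ fun x _ => ?_) ((hU.abs.const_mul _).intervalIntegrable _ _)
          rw [← abs_mul, mul_sub]
          exact norm_exp_mul_I_sub_exp_mul_I_le _ _
      _ = |t| * ∫ x in (0 : ℝ)..1, |S x - Y x| := intervalIntegral.integral_const_mul _ _
      _ ≤ _ := mul_le_mul_of_nonneg_left hU1 (abs_nonneg _)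
  have hmoment : |(∫ x in (0 : ℝ)..1, S x ^ 2) - ∫ x in (0 : ℝ)..1, Y x ^ 2| ≤
      θ * (C + 1) + θ ^ 2 := by
    rw [← intervalIntegral.integral_sub (hS.sq.intervalIntegrable _ _)
      (hY.sq.intervalIntegrable _ _), ← Real.norm_eq_abs]
    have hb1 := hS.sq.const_mul θ
    have hb2 := hU.sq.const_mul (θ⁻¹ + 1)
    -- With `U = S - Y`, `S² - Y² = 2 S U - U²`, and the cross term is split by the weighted
    -- arithmetic–geometric inequality.
    calc _ ≤ ∫ x in (0 : ℝ)..1, (θ * S x ^ 2 + (θ⁻¹ + 1) * (S x - Y x) ^ 2) := by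
          refine intervalIntegral.norm_integral_le_of_norm_le zero_le_one
            (ae_of_all _ fun x _ => ?_) ((hb1.add hb2).intervalIntegrable _ _)
          have hθi : θ * θ⁻¹ = 1 := mul_inv_cancel₀ hθ.ne'
          have key : ∀ a b : ℝ, 2 * (a * b) ≤ θ * a ^ 2 + θ⁻¹ * b ^ 2 := fun a b => by
            have h := mul_nonneg hθ.le (sq_nonneg (a - θ⁻¹ * b))
            have e : θ * (a - θ⁻¹ * b) ^ 2 = θ * a ^ 2 - 2 * (θ * θ⁻¹) * (a * b) +
              (θ * θ⁻¹) * θ⁻¹ * b ^ 2 := by ring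
            rw [e, hθi] at h
            linarith
          have k1 := key (S x) (S x - Y x)
          have k2 := key (S x) (-(S x - Y x))
          rw [Real.norm_eq_abs, abs_le]
          constructor <;> nlinarith [sq_nonneg (S x - Y x)]
      _ = θ * (∫ x in (0 : ℝ)..1, S x ^ 2) +
          (θ⁻¹ + 1) * ∫ x in (0 : ℝ)..1, (S x - Y x) ^ 2 := by
          rw [intervalIntegral.integral_add (hb1.intervalIntegrable _ _)
            (hb2.intervalIntegrable _ _), intervalIntegral.integral_const_mul,
            intervalIntegral.integral_const_mul]
      _ ≤ θ * C + (θ⁻¹ + 1) * θ ^ 2 := by gcongr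
      _ = _ := by field_simp; ring
  have hnn : ∀ u : ℝ → ℝ, 0 ≤ ∫ x in (0 : ℝ)..1, u x ^ 2 := fun u =>
    intervalIntegral.integral_nonneg zero_le_one fun x _ => sq_nonneg _
  have h2 : ‖(Real.exp (-(t ^ 2 * (∫ x in (0 : ℝ)..1, Y x ^ 2) / 2)) : ℂ) -
      (Real.exp (-(t ^ 2 * (∫ x in (0 : ℝ)..1, S x ^ 2) / 2)) : ℂ)‖ ≤
      t ^ 2 * (θ * (C + 1) + θ ^ 2) := by
    rw [← Complex.ofReal_sub, Complex.norm_real, Real.norm_eq_abs, abs_sub_comm]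
    refine (abs_exp_neg_half_sub_le (mul_nonneg (sq_nonneg t) (hnn S))
      (mul_nonneg (sq_nonneg t) (hnn Y))).trans ?_
    rw [← mul_sub, abs_mul, abs_of_nonneg (sq_nonneg t)]
    exact mul_le_mul_of_nonneg_left hmoment (sq_nonneg t)
  set φS := ∫ x in (0 : ℝ)..1, Complex.exp ((t * S x : ℝ) * Complex.I)
  set φY := ∫ x in (0 : ℝ)..1, Complex.exp ((t * Y x : ℝ) * Complex.I)
  set gS := (Real.exp (-(t ^ 2 * (∫ x in (0 : ℝ)..1, S x ^ 2) / 2)) : ℂ)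
  set gY := (Real.exp (-(t ^ 2 * (∫ x in (0 : ℝ)..1, Y x ^ 2) / 2)) : ℂ)
  calc ‖φS - gS‖ = ‖(φS - φY) + (gY - gS) + (φY - gY)‖ := by congr 1; ring
    _ ≤ _ := (norm_add_le _ _).trans (add_le_add ((norm_add_le _ _).trans (add_le_add h1 h2))
        le_rfl)

/-- Normal approximation of the characteristic function of normalized lacunary sums, uniformly over
all sequences with given gap ratio and counting function. -/
theorem exists_norm_integral_exp_lacunary_sub_gaussian_le {f : ℝ → ℝ} (hf : BoundedMeasurable f)
    (hfper : Function.Periodic f 1) (hmean : ∫ x in (0 : ℝ)..1, f x = 0)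
    (hvar : BoundedVariationOn f (Icc (0 : ℝ) 1)) {q : ℝ} (hq : 1 < q) (K : ℤ → ℤ → ℕ) (t : ℝ)
    {ε : ℝ} (hε : 0 < ε) :
    ∃ N₀ : ℕ, ∀ N, N₀ ≤ N → ∀ m : ℕ → ℕ, LacunaryB2 q K m →
      ‖(∫ x in (0 : ℝ)..1, Complex.exp ((t * ((√(N : ℝ))⁻¹ *
          ∑ i ∈ Finset.range N, f (m i * x)) : ℝ) * Complex.I)) -
        (Real.exp (-(t ^ 2 * (∫ x in (0 : ℝ)..1, ((√(N : ℝ))⁻¹ *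
          ∑ i ∈ Finset.range N, f (m i * x)) ^ 2) / 2)) : ℂ)‖ ≤ ε := by
  obtain ⟨C, hC0, hC⟩ := exists_integral_sq_lacunary_sum_le hf hfper hmean hvar hq K
  -- For `θ ≤ 1` the total perturbation error is at most `θ * Q`; the final `1` keeps `Q` positive.
  set Q : ℝ := |t| + t ^ 2 * (C + 2) + 1 with hQ
  have hQ0 : 0 < Q := by positivity
  set θ : ℝ := min 1 (ε / (2 * Q)) with hθdef
  have hθ : 0 < θ := lt_min one_pos (by positivity)
  have hθ1 : θ ≤ 1 := min_le_left _ _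
  have hθQ : θ * Q ≤ ε / 2 := by
    have : θ ≤ ε / (2 * Q) := min_le_right _ _
    calc θ * Q ≤ ε / (2 * Q) * Q := by gcongr
      _ = ε / 2 := by field_simp
  obtain ⟨d, c, p, s, L, hp, hs, hsL, hL, happ⟩ :=
    exists_block_approximation hf hfper hmean hvar hq K (pow_pos hθ 2)
  obtain ⟨D, hD⟩ := hp.exists_norm_integral_exp_sub_le hq K hs hsL hL t
  have hlim : Tendsto (fun N : ℕ => D / √(N : ℝ)) atTop (𝓝 0) :=
    tendsto_const_nhds.div_atTop (Real.tendsto_sqrt_atTop.comp tendsto_natCast_atTop_atTop)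
  obtain ⟨N₁, hN₁⟩ := eventually_atTop.1 (hlim.eventually_lt_const (half_pos hε))
  refine ⟨max L N₁, fun N hN m hm => ?_⟩
  have hLN : L ≤ N := (le_max_left _ _).trans hN
  have hN1 := hN₁ N ((le_max_right _ _).trans hN)
  have hS : BoundedMeasurable fun x => (√(N : ℝ))⁻¹ * ∑ i ∈ Finset.range N, f (m i * x) :=
    (BoundedMeasurable.sum _ fun i => hf.comp_mul _).const_mul _
  have hY : BoundedMeasurable fun x => (√(N : ℝ))⁻¹ *
      ∑ i ∈ (Finset.range N).filter fun i => i % L < L - s, p (m i * x) :=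
    (BoundedMeasurable.sum _ fun i => hp.boundedMeasurable.comp_mul _).const_mul _
  have h1 := norm_integral_exp_sub_gaussian_le hS hY hθ (hC N m hm) (happ N hLN m hm) t
  have h2 := hD N (hL.trans_le hLN) m hm
  have h3 : |t| * θ + t ^ 2 * (θ * (C + 1) + θ ^ 2) ≤ θ * Q := by
    have : θ ^ 2 ≤ θ := by nlinarith
    have : t ^ 2 * θ ^ 2 ≤ t ^ 2 * θ := mul_le_mul_of_nonneg_left this (sq_nonneg t)
    rw [hQ]
    nlinarith
  linarith

/-! ### Increasing rearrangement -/

/-- The enumeration is continued past the maximum of `A`, since the lacunarity conditions concern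
infinite sequences; the continuation never enters the sum. -/
theorem exists_strictMono_image_range_eq (A : Finset ℕ) :
    ∃ τ : ℕ → ℕ, StrictMono τ ∧ (Finset.range A.card).image τ = A := by
  induction A using Finset.induction_on_max with
  | empty => exact ⟨id, strictMono_id, by simp⟩
  | insert M A hM ih =>
    obtain ⟨τ, hτ, himg⟩ := ih
    have hMA : M ∉ A := fun h => lt_irrefl _ (hM M h)
    have hlt : ∀ i, i < A.card → τ i < M := fun i hi => hM _ (by
      rw [← himg]
      exact Finset.mem_image_of_mem _ (Finset.mem_range.2 hi))
    refine ⟨fun i => if i < A.card then τ i else M + (i - A.card),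
      strictMono_nat_of_lt_succ fun i => ?_, ?_⟩
    · rcases lt_trichotomy (i + 1) A.card with h | h | h
      · simp only [h, (Nat.lt_succ_self i).trans h, if_true]
        exact hτ (Nat.lt_succ_self i)
      · have h' : i < A.card := by omega
        simp only [h', if_true, h, lt_irrefl, if_false]
        have := hlt i h'
        omega
      · have h1 : ¬ i < A.card := by omega
        have h2 : ¬ i + 1 < A.card := by omega
        simp only [h1, h2, if_false]
        omega
    · rw [Finset.card_insert_of_notMem hMA, Finset.range_add_one, Finset.image_insert]
      simp only [lt_irrefl, if_false, Nat.sub_self, add_zero]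
      congr 1
      conv_rhs => rw [← himg]
      refine Finset.image_congr fun i hi => ?_
      have : i < A.card := Finset.mem_range.1 hi
      simp only [this, if_true]

/-- Omitting terms only widens gaps, and solutions along a subsequence inject into solutions along
the whole sequence, so `q` and `K` persist. -/
theorem LacunaryB2.comp_strictMono {q : ℝ} (hq : 1 < q) {K : ℤ → ℤ → ℕ} {n : ℕ → ℕ}
    (hn : LacunaryB2 q K n) {τ : ℕ → ℕ} (hτ : StrictMono τ) : LacunaryB2 q K (n ∘ τ) where
  pos i := hn.pos _
  gap i := (hn.gap (τ i)).trans (by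
    exact_mod_cast (hn.strictMono hq).monotone (hτ (Nat.lt_succ_self i)))
  count a b ha hb c hc := by
    refine le_trans (Set.encard_le_encard_of_injOn (f := Prod.map τ τ) (fun p hp => hp) ?_)
      (hn.count a b ha hb c hc)
    exact (hτ.injective.prodMap hτ.injective).injOn

theorem exists_lacunaryB2_of_conditionB2 {n : ℕ → ℕ} (hpos : ∀ k, 0 < n k) (hgap : HadamardGap n)
    (hB : ConditionB2 n) : ∃ (q : ℝ) (K : ℤ → ℤ → ℕ), 1 < q ∧ LacunaryB2 q K n := by
  obtain ⟨q, hq, hgap⟩ := hgap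
  choose! K hK using hB
  refine ⟨q, K, hq, hpos, fun i => ?_, fun a b ha hb c hc => hK a b ha hb c hc⟩
  have : (0 : ℝ) < n i := by exact_mod_cast hpos i
  exact (le_div_iff₀ this).1 (hgap i)

/-- The increasing rearrangement of the first `N` terms of a permuted sequence. -/
theorem exists_strictMono_permSum_eq (n : ℕ → ℕ) (σ : Equiv.Perm ℕ) (N : ℕ) :
    ∃ τ : ℕ → ℕ, StrictMono τ ∧ ∀ (f : ℝ → ℝ) (x : ℝ),
      permSum f n σ N x = ∑ i ∈ Finset.range N, f (((n ∘ τ) i : ℕ) * x) := by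
  obtain ⟨τ, hτ, himg⟩ := exists_strictMono_image_range_eq ((Finset.range N).image σ)
  rw [Finset.card_image_of_injective _ σ.injective, Finset.card_range] at himg
  refine ⟨τ, hτ, fun f x => ?_⟩
  rw [permSum, ← Finset.sum_image (s := Finset.range N) (g := σ) (f := fun k => f (n k * x))
    σ.injective.injOn, ← himg, Finset.sum_image hτ.injective.injOn]
  rfl

/-! ### Convergence in law and the main theorem -/

theorem convergesToLaw_iff_tendsto_charFun {X : ℕ → ℝ → ℝ} (hX : ∀ N, BoundedMeasurable (X N))
    (ν : Measure ℝ) [IsProbabilityMeasure ν] :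
    ConvergesToLaw X ν ↔ ∀ t : ℝ, Tendsto (fun N => ∫ x in (0 : ℝ)..1,
      Complex.exp ((t * X N x : ℝ) * Complex.I)) atTop (𝓝 (charFun ν t)) := by
  have hchar : ∀ N t, charFun (lebesgueUnit.map (X N)) t = ∫ x in (0 : ℝ)..1,
      Complex.exp ((t * X N x : ℝ) * Complex.I) := fun N t => by
    rw [charFun_apply_real, integral_map (hX N).1.aemeasurable
      (Measurable.aestronglyMeasurable (by fun_prop)), integral_lebesgueUnit]
    simp only [Complex.ofReal_mul]
  have hae : ∀ N, AEMeasurable (X N) lebesgueUnit := fun N => (hX N).1.aemeasurable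
  constructor
  · intro h t
    have := ProbabilityMeasure.tendsto_iff_tendsto_charFun.1 h.tendsto t
    simpa only [ProbabilityMeasure.coe_mk, hchar, Measure.map_id] using this
  · intro h
    refine ⟨hae, aemeasurable_id, ProbabilityMeasure.tendsto_iff_tendsto_charFun.2 fun t => ?_⟩
    simpa only [ProbabilityMeasure.coe_mk, hchar, Measure.map_id] using h t

theorem theorem5 (n : ℕ → ℕ) (hpos : ∀ k, 0 < n k) (hgap : HadamardGap n) (hB : ConditionB2 n)
    (f : ℝ → ℝ) (hmeas : Measurable f) (hper : ∀ x, f (x + 1) = f x)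
    (hmean : ∫ x in (0 : ℝ)..1, f x = 0) (hvar : BoundedVariationOn f (Icc (0 : ℝ) 1))
    (σ : Equiv.Perm ℕ) :
    ((∃ (ν : Measure ℝ) (_ : IsProbabilityMeasure ν),
        ConvergesToLaw (fun N x => (√(N : ℝ))⁻¹ * permSum f n σ N x) ν) ↔
      ∃ γ : ℝ, IsLimitingVariance f n σ γ) ∧
    (∀ γ : ℝ, IsLimitingVariance f n σ γ →
      0 ≤ γ ∧
      ConvergesToLaw (fun N x => (√(N : ℝ))⁻¹ * permSum f n σ N x)
        (gaussianReal 0 γ.toNNReal)) := by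
  obtain ⟨q, K, hq, hn⟩ := exists_lacunaryB2_of_conditionB2 hpos hgap hB
  obtain ⟨M, _, hM⟩ := exists_bound_of_boundedVariation hper hvar
  have hf : BoundedMeasurable f := ⟨hmeas, M, hM⟩
  -- The rearrangement changes with `N`, which is why the normal approximation must be uniform in
  -- the sequence.
  choose τ hτ hperm using exists_strictMono_permSum_eq n σ
  have hm : ∀ N, LacunaryB2 q K (n ∘ τ N) := fun N => hn.comp_strictMono hq (hτ N)
  set X : ℕ → ℝ → ℝ := fun N x => (√(N : ℝ))⁻¹ * permSum f n σ N x with hX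
  have hXb : ∀ N, BoundedMeasurable (X N) := fun N =>
    (BoundedMeasurable.sum (Finset.range N) fun k => hf.comp_mul (n (σ k))).const_mul _
  set v : ℕ → ℝ := fun N => ∫ x in (0 : ℝ)..1, X N x ^ 2 with hv
  have hvlim : ∀ γ, IsLimitingVariance f n σ γ ↔ Tendsto v atTop (𝓝 γ) := fun γ => by
    rw [IsLimitingVariance]
    refine tendsto_congr fun N => ?_
    simp only [hv, hX, mul_pow, intervalIntegral.integral_const_mul, inv_pow,
      Real.sq_sqrt (Nat.cast_nonneg N)]
  have hv0 : ∀ N, 0 ≤ v N := fun N =>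
    intervalIntegral.integral_nonneg zero_le_one fun x _ => sq_nonneg _
  have key : ∀ t : ℝ, Tendsto (fun N => (∫ x in (0 : ℝ)..1,
      Complex.exp ((t * X N x : ℝ) * Complex.I)) - (Real.exp (-(t ^ 2 * v N / 2)) : ℂ))
      atTop (𝓝 0) := by
    intro t
    rw [Metric.tendsto_atTop]
    intro ε hε
    obtain ⟨N₀, hN₀⟩ := exists_norm_integral_exp_lacunary_sub_gaussian_le hf hper hmean hvar hq K t
      (half_pos hε)
    refine ⟨N₀, fun N hN => ?_⟩
    rw [dist_zero_right]
    refine lt_of_le_of_lt ?_ (half_lt_self hε)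
    simpa only [hv, hX, hperm N] using hN₀ N hN _ (hm N)
  have hsuff : ∀ γ : ℝ, Tendsto v atTop (𝓝 γ) →
      0 ≤ γ ∧ ConvergesToLaw X (gaussianReal 0 γ.toNNReal) := by
    intro γ hγ
    have hγ0 : 0 ≤ γ := ge_of_tendsto' hγ hv0
    refine ⟨hγ0, (convergesToLaw_iff_tendsto_charFun hXb _).2 fun t => ?_⟩
    have h1 : Tendsto (fun N => (Real.exp (-(t ^ 2 * v N / 2)) : ℂ)) atTop
        (𝓝 (Real.exp (-(t ^ 2 * γ / 2)) : ℂ)) := by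
      have hc : Continuous fun y : ℝ => (Real.exp (-(t ^ 2 * y / 2)) : ℂ) := by fun_prop
      exact (hc.tendsto γ).comp hγ
    have h2 := (key t).add h1
    simp only [sub_add_cancel, zero_add] at h2
    convert h2 using 2
    rw [charFun_gaussianReal, Complex.ofReal_exp]
    congr 1
    have : ((γ.toNNReal : ℝ) : ℂ) = γ := by rw [Real.coe_toNNReal γ hγ0]
    push_cast
    rw [← this]
    simp
    ring
  refine ⟨⟨?_, ?_⟩, fun γ hγ => hsuff γ ((hvlim γ).1 hγ)⟩
  · rintro ⟨ν, hν, hconv⟩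
    obtain ⟨C, _, hC⟩ := exists_integral_sq_lacunary_sum_le hf hper hmean hvar hq K
    have hvC : ∀ N, v N ≤ C := fun N => by
      simpa only [hv, hX, hperm N] using hC N _ (hm N)
    have h1 := ((convergesToLaw_iff_tendsto_charFun hXb ν).1 hconv 1).sub (key 1)
    simp only [sub_sub_cancel, sub_zero, one_pow, one_mul] at h1
    have h2 : Tendsto (fun N => Real.exp (-(v N / 2))) atTop (𝓝 (charFun ν 1).re) := by
      have := (Complex.continuous_re.tendsto _).comp h1
      simpa only [Function.comp_def, Complex.ofReal_re] using this
    -- Boundedness of the second moments keeps the limit away from zero, where the logarithm would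
    -- fail.
    have hpos' : 0 < (charFun ν 1).re :=
      (Real.exp_pos (-(C / 2))).trans_le (ge_of_tendsto' h2 fun N =>
        Real.exp_le_exp.2 (by linarith [hvC N]))
    have h3 := (((Real.continuousAt_log hpos'.ne').tendsto.comp h2).const_mul (-2))
    refine ⟨_, (hvlim _).2 (h3.congr fun N => ?_)⟩
    simp only [Function.comp_apply, Real.log_exp]
    ring
  · rintro ⟨γ, hγ⟩
    exact ⟨_, inferInstance, (hsuff γ ((hvlim γ).1 hγ)).2⟩
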